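/- Let $n,k\ge 0$ be integers, let $c\in\mathbb{C}$, let $a_0,\dots,a_n\in\mathbb{C}$ with $a_n\neq 0$ and $b_0,\dots,b_k\in\mathbb{C}$ with $b_k\neq 0$. For a meromorphic function $f$ on $\mathbb{C}$ put $$L^n_c(f)(z)=\sum_{j=0}^{n}a_jf(z+jc),\qquad L_k[f](z)=\sum_{j=1}^{k}b_jf^{(j)}(z)+b_0 .$$ Let $f$ be a transcendental (that is, non-rational) meromorphic function on $\mathbb{C}$ whose order of growth $\sigma(f)=\limsup_{r\to\infty}\frac{\log^+ T(r,f)}{\log r}$, with $T(r,f)$ the Nevanlinna characteristic, is neither an integer nor infinite, and suppose that $f(z+c)\not\equiv f(z)$. Let $a,b\in\mathbb{C}$ with $a\neq b$. If $L^n_c(f)+L_k[f]$ and $f$ share $a$, $b$ and $\infty$ CM (that is, $L^n_c(f)+L_k[f]-d$ and $f-d$ have the same zeros with the same multiplicities for $d=a$ and for $d=b$, and $L^n_c(f)+L_k[f]$ and $f$ have the same poles with the same multiplicities), then $L^n_c(f)+L_k[f]\equiv f$. -/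

import Mathlib

open Filter Polynomial

namespace MeroShare

/-!
A meromorphic function on `ℂ` is a function `f : ℂ → ℂ` with `Meromorphic f`; its values on a
discrete set (in particular at the poles) carry no information. Identity `≡` of meromorphic
functions is therefore equality off a closed discrete set, `=ᶠ[codiscrete ℂ]`.
-/

/-- The meromorphic function `f` is transcendental: it is not a rational function. -/
def IsTranscendental (f : ℂ → ℂ) : Prop :=
  ¬ ∃ p q : ℂ[X], q ≠ 0 ∧ f =ᶠ[codiscrete ℂ] fun z => p.eval z / q.eval z

/-- The order of growth `σ(f) = limsup_{r → ∞} log⁺ T(r, f) / log r`, where `T(r, f)` is the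
Nevanlinna characteristic. It takes values in the extended reals. -/
noncomputable def growthOrder (f : ℂ → ℂ) : EReal :=
  limsup (fun r : ℝ =>
    ((Real.posLog (ValueDistribution.characteristic f ⊤ r) / Real.log r : ℝ) : EReal)) atTop

/-- `f` and `g` share the finite value `a` CM: at each point, `f - a` and `g - a` have zeros of the
same multiplicity (multiplicity `0` meaning that there is no zero). -/
def ShareCM (f g : ℂ → ℂ) (a : ℂ) : Prop :=
  ∀ z : ℂ, max (meromorphicOrderAt (fun w => f w - a) z) 0 =
    max (meromorphicOrderAt (fun w => g w - a) z) 0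

/-- `f` and `g` share the value `∞` CM: at each point, `f` and `g` have poles of the same
multiplicity (multiplicity `0` meaning that there is no pole). -/
def ShareInftyCM (f g : ℂ → ℂ) : Prop :=
  ∀ z : ℂ, min (meromorphicOrderAt f z) 0 = min (meromorphicOrderAt g z) 0

/-- The linear difference polynomial `L^n_c(f)(z) = ∑_{j=0}^n a_j f(z + j c)`. -/
noncomputable def diffPoly (n : ℕ) (a : ℕ → ℂ) (c : ℂ) (f : ℂ → ℂ) : ℂ → ℂ :=
  fun z => ∑ j ∈ Finset.range (n + 1), a j * f (z + j * c)

/-- The linear differential polynomial `L_k[f] = b_k f^{(k)} + ⋯ + b_1 f' + b_0`; the last term is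
the constant `b_0`. -/
noncomputable def derivPoly (k : ℕ) (b : ℕ → ℂ) (f : ℂ → ℂ) : ℂ → ℂ :=
  fun z => (∑ j ∈ Finset.Icc 1 k, b j * iteratedDeriv j f z) + b 0

end MeroShare

namespace MeroShare

open Real MeasureTheory Metric Set Topology ValueDistribution

/-! Write g for the difference-differential expression in f. Sharing a and ∞ CM makes (g - a)/(f -
a) an entire function without zeros, and likewise for b. As f has finite order, T(r, f) is bounded
by a polynomial in r, and the proximity functions of both quotients inherit such a bound; so the
quotients are e^P and e^Q with polynomials P and Q (`exists_eq_exp_mul_of_share`). If g ≢ f then e^P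
≢ e^Q, and eliminating g gives f - a = (b - a)(1 - e^Q)/(e^P - e^Q). Such a function has order
exactly d = max(deg P, deg Q), an integer, which is the contradiction.

The upper bound T(r, f) = O(r^d) follows from the first main theorem
(`exists_characteristic_le_mul_pow`). For the lower bound c r^d (`exists_le_characteristic`),
compare leading coefficients p and q with |q| ≤ |p|. If p = q, both exponentials are small on a
sector, where f is therefore large. If p ≠ q, e^P dominates both 1 and e^Q on some sector, where f -
a is small.

Polynomial growth passes from f to g through the class `IsTame`: on the disc of radius R the
function is F/∏(z - a_i), with log|F| and the number of factors polynomially bounded in R. This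
class is closed under sums, products, shifts and, by Cauchy's estimate, derivatives. -/

/-! ### Pointwise bounds for analytic functions from circle averages. -/

/-- Subharmonicity of log⁺|F|: in Jensen's formula the zeros in the disc contribute nonnegative
terms. -/
theorem posLog_norm_le_circleAverage {F : ℂ → ℂ} {z : ℂ} {t : ℝ} (ht : 0 < t)
    (hF : AnalyticOnNhd ℂ F (closedBall z t)) :
    log⁺ ‖F z‖ ≤ circleAverage (fun w => log⁺ ‖F w‖) z t := by
  have habs : |t| = t := abs_of_pos ht
  have hF' : AnalyticOnNhd ℂ F (closedBall z |t|) := by rwa [habs]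
  have hs : MeromorphicOn F (sphere z |t|) :=
    fun x hx => (hF' x (sphere_subset_closedBall hx)).meromorphicAt
  have h0 : 0 ≤ circleAverage (fun w => log⁺ ‖F w‖) z t :=
    circleAverage_nonneg_of_nonneg fun x _ => posLog_nonneg
  rw [posLog_apply]
  refine max_le h0 ?_
  by_cases hz : F z = 0
  · simpa [hz] using h0
  have h1 : 0 ≤ ∑ᶠ u, MeromorphicOn.divisor F (closedBall z |t|) u * Real.log (t * ‖z - u‖⁻¹) := by
    refine finsum_nonneg fun u => ?_
    by_cases hu : u ∈ closedBall z |t|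
    · refine mul_nonneg ?_ ?_
      · exact_mod_cast MeromorphicOn.AnalyticOnNhd.divisor_nonneg hF' u
      · by_cases hzu : z = u
        · simp [hzu]
        · have : 0 < ‖z - u‖ := norm_pos_iff.2 (sub_ne_zero.2 hzu)
          refine Real.log_nonneg ?_
          rw [← div_eq_mul_inv, le_div_iff₀ this, one_mul, ← dist_eq_norm, dist_comm]
          simpa [habs] using hu
    · simp [hu]
  calc Real.log ‖F z‖ ≤ circleAverage (Real.log ‖F ·‖) z t := by
        rw [hF'.circleAverage_log_norm ht.ne' hz]; linarith
    _ ≤ _ := circleAverage_mono hs.circleIntegrable_log_norm hs.circleIntegrable_posLog_norm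
        fun x _ => by rw [posLog_apply]; exact le_max_right _ _

theorem lintegral_polar (u : ℂ → ENNReal) (hu : Measurable u) :
    ∫⁻ w, u w = ∫⁻ t in Ioi (0 : ℝ), ENNReal.ofReal t *
      ∫⁻ θ in Ioo (-π) π, u (circleMap 0 t θ) := by
  rw [← Complex.lintegral_comp_polarCoord_symm, polarCoord_target, Measure.volume_eq_prod,
    ← Measure.prod_restrict, lintegral_prod]
  · refine lintegral_congr fun t => ?_
    rw [← lintegral_const_mul]
    · refine lintegral_congr fun θ => ?_
      simp [Complex.polarCoord_symm_apply, circleMap, Complex.exp_mul_I]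
    · exact hu.comp (by fun_prop)
  · refine Measurable.aemeasurable ?_
    have : Measurable fun p : ℝ × ℝ => Complex.polarCoord.symm p := by
      simp only [Complex.polarCoord_symm_apply]; fun_prop
    simp only [smul_eq_mul]
    exact (by fun_prop : Measurable fun p : ℝ × ℝ => ENNReal.ofReal p.1).mul (hu.comp this)

theorem lintegral_circle {v : ℂ → ℝ} {z : ℂ} {t : ℝ} (hv : CircleIntegrable v z t)
    (h0 : ∀ w, 0 ≤ v w) :
    ∫⁻ θ in Ioo (-π) π, ENNReal.ofReal (v (circleMap z t θ)) =
      ENNReal.ofReal (2 * π * circleAverage v z t) := by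
  have hper : (fun θ => v (circleMap z t θ)).Periodic (2 * π) := fun x => by
    simp [periodic_circleMap z t x]
  have hint : IntervalIntegrable (fun θ => v (circleMap z t θ)) volume (-π) π := by
    have := hper.intervalIntegrable (t := 0) (by positivity) (by simpa [CircleIntegrable] using hv) (-π) π
    exact this
  have h1 : 2 * π * circleAverage v z t = ∫ θ in Ioo (-π) π, v (circleMap z t θ) := by
    rw [circleAverage_def, smul_eq_mul, ← mul_assoc, mul_inv_cancel₀ (by positivity), one_mul,
      ← integral_Ioc_eq_integral_Ioo, ← intervalIntegral.integral_of_le (by linarith [pi_pos])]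
    have := hper.intervalIntegral_add_eq (-π) 0
    rw [show -π + 2 * π = π by ring, zero_add] at this
    exact this.symm
  rw [h1, ofReal_integral_eq_lintegral_ofReal]
  · exact ((intervalIntegrable_iff_integrableOn_Ioo_of_le (by linarith [pi_pos])).1 hint)
  · exact Eventually.of_forall fun _ => h0 _

theorem lintegral_id_Ioo (a b : ℝ) (h : 0 ≤ a) (hab : a ≤ b) : ∫⁻ t in Ioo a b, ENNReal.ofReal t =
    ENNReal.ofReal ((b ^ 2 - a ^ 2) / 2) := by
  rw [← integral_id, intervalIntegral.integral_of_le hab, integral_Ioc_eq_integral_Ioo,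
    ofReal_integral_eq_lintegral_ofReal]
  · exact (continuous_id.integrableOn_Icc).mono_set Ioo_subset_Icc_self
  · filter_upwards [self_mem_ae_restrict measurableSet_Ioo] with x hx
    exact h.trans hx.1.le

theorem lintegral_ball_ge {u : ℂ → ENNReal} (hu : Measurable u) {z : ℂ} {c : ENNReal}
    (h : ∀ t ∈ Ioo (0 : ℝ) 1, c ≤ ∫⁻ θ in Ioo (-π) π, u (circleMap z t θ)) :
    ENNReal.ofReal (1 / 2) * c ≤ ∫⁻ w in ball z 1, u w := by
  have hm : Measurable ((ball (0 : ℂ) 1).indicator fun w => u (w + z)) :=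
    (hu.comp (measurable_add_const z)).indicator measurableSet_ball
  have key : ∫⁻ w in ball z 1, u w = ∫⁻ w, (ball (0 : ℂ) 1).indicator (fun w => u (w + z)) w := by
    rw [← lintegral_indicator measurableSet_ball,
      ← lintegral_add_right_eq_self _ z]
    refine lintegral_congr fun w => ?_
    simp [indicator, dist_eq_norm]
  rw [key, lintegral_polar _ hm]
  calc ENNReal.ofReal (1 / 2) * c = ∫⁻ t in Ioo (0 : ℝ) 1, ENNReal.ofReal t * c := by
        rw [lintegral_mul_const _ (by fun_prop), lintegral_id_Ioo 0 1 le_rfl zero_le_one]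
        norm_num
    _ ≤ ∫⁻ t in Ioo (0 : ℝ) 1, ENNReal.ofReal t * ∫⁻ θ in Ioo (-π) π,
          (ball (0 : ℂ) 1).indicator (fun w => u (w + z)) (circleMap 0 t θ) := by
        refine setLIntegral_mono' measurableSet_Ioo fun t ht => ?_
        gcongr
        refine (h t ht).trans (le_of_eq (lintegral_congr fun θ => ?_))
        rw [indicator_of_mem]
        · congr 1
          simp [circleMap, add_comm]
        · simp [abs_of_pos ht.1, ht.2]
    _ ≤ _ := lintegral_mono_set fun t ht => ht.1

theorem lintegral_annulus_le {u : ℂ → ENNReal} (hu : Measurable u) {R : ℝ} (hR : 1 ≤ R)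
    {m : ENNReal}
    (h : ∀ t ∈ Ioo (R - 1) (R + 1), ∫⁻ θ in Ioo (-π) π, u (circleMap 0 t θ) ≤ m) :
    ∫⁻ w in {w : ℂ | ‖w‖ ∈ Ioo (R - 1) (R + 1)}, u w ≤ ENNReal.ofReal (2 * R) * m := by
  have hms : MeasurableSet {w : ℂ | ‖w‖ ∈ Ioo (R - 1) (R + 1)} :=
    measurable_norm measurableSet_Ioo
  rw [← lintegral_indicator hms, lintegral_polar _ (hu.indicator hms)]
  calc _ ≤ ∫⁻ t in Ioi (0 : ℝ), (Ioo (R - 1) (R + 1)).indicator (fun t => ENNReal.ofReal t * m) t := by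
        refine setLIntegral_mono' measurableSet_Ioi fun t ht => ?_
        have hn : ∀ θ, ‖circleMap 0 t θ‖ = t := fun θ => by simp [abs_of_pos ht.out]
        by_cases hT : t ∈ Ioo (R - 1) (R + 1)
        · rw [indicator_of_mem hT]
          gcongr
          refine le_trans (le_of_eq (lintegral_congr fun θ => ?_)) (h t hT)
          rw [indicator_of_mem]
          simpa only [mem_ofPred_eq, hn] using hT
        · rw [indicator_of_notMem hT]
          refine le_of_eq ?_
          have : ∀ θ, {w : ℂ | ‖w‖ ∈ Ioo (R - 1) (R + 1)}.indicator u (circleMap 0 t θ) = 0 :=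
            fun θ => indicator_of_notMem (by simpa only [mem_ofPred_eq, hn] using hT) _
          simp only [this, lintegral_zero, mul_zero]
    _ ≤ ∫⁻ t, (Ioo (R - 1) (R + 1)).indicator (fun t => ENNReal.ofReal t * m) t :=
        setLIntegral_le_lintegral _ _
    _ = _ := by
        rw [lintegral_indicator measurableSet_Ioo, lintegral_mul_const _ (by fun_prop),
          lintegral_id_Ioo _ _ (by linarith) (by linarith)]
        congr 2; ring

/-- An analytic function whose proximity function is bounded by `M` is bounded by
`exp (4 * R * M)` on the disc of radius `R`. -/
theorem norm_le_exp_of_circleAverage_le {F : ℂ → ℂ} {R M : ℝ} (hR : 2 ≤ R)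
    (hF : AnalyticOnNhd ℂ F (closedBall 0 (R + 1)))
    (hM : ∀ t ∈ Ioo (R - 1) (R + 1), circleAverage (fun w => log⁺ ‖F w‖) 0 t ≤ M) :
    ∀ z ∈ closedBall (0 : ℂ) R, ‖F z‖ ≤ Real.exp (4 * R * M) := by
  have hM0 : 0 ≤ M := (circleAverage_nonneg_of_nonneg (f := fun w => log⁺ ‖F w‖)
    fun x _ => posLog_nonneg).trans (hM R ⟨by linarith, by linarith⟩)
  -- The cutoff makes the integrand measurable on the whole plane, as the polar coordinate lemmas
  -- require.
  set v : ℂ → ℝ := (closedBall 0 (R + 1)).indicator fun w => log⁺ ‖F w‖ with hv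
  have hv0 : ∀ w, 0 ≤ v w := fun w => indicator_nonneg (fun _ _ => posLog_nonneg) w
  have hve : ∀ w ∈ closedBall (0 : ℂ) (R + 1), v w = log⁺ ‖F w‖ := fun w hw => indicator_of_mem hw _
  have hvm : Measurable v := by
    have hc : ContinuousOn (fun w => log⁺ ‖F w‖) (closedBall 0 (R + 1)) :=
      continuous_posLog.comp_continuousOn hF.continuousOn.norm
    classical
    rw [hv, ← piecewise_eq_indicator]
    exact hc.measurable_piecewise continuousOn_const measurableSet_closedBall
  have havg : ∀ (z : ℂ) (t : ℝ), 0 < t → closedBall z t ⊆ closedBall 0 (R + 1) →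
      ∫⁻ θ in Ioo (-π) π, ENNReal.ofReal (v (circleMap z t θ)) =
        ENNReal.ofReal (2 * π * circleAverage (fun w => log⁺ ‖F w‖) z t) := by
    intro z t ht hsub
    have hEq : EqOn v (fun w => log⁺ ‖F w‖) (sphere z |t|) := fun w hw =>
      hve w (hsub (by rw [abs_of_pos ht] at hw; exact sphere_subset_closedBall hw))
    rw [← circleAverage_congr_sphere hEq]
    refine lintegral_circle ?_ hv0
    refine (CircleIntegrable.congr_codiscreteWithin (f₁ := fun w => log⁺ ‖F w‖) ?_ ?_)
    · filter_upwards [self_mem_codiscreteWithin _] with w hw using (hEq hw).symm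
    · refine MeromorphicOn.circleIntegrable_posLog_norm fun w hw => (hF w (hsub ?_)).meromorphicAt
      rw [abs_of_pos ht] at hw; exact sphere_subset_closedBall hw
  -- The unit disc about z lies in the annulus R - 1 < |w| < R + 1. Circles about z bound the area
  -- integral over the disc below by π log⁺|F z|; circles about 0 bound the one over the annulus
  -- above by 2R · 2πM. The quotient is 4RM.
  have hsphere : ∀ z ∈ sphere (0 : ℂ) R, ‖F z‖ ≤ Real.exp (4 * R * M) := by
    intro z hz
    have hzn : ‖z‖ = R := by simpa using hz
    have hsub : ∀ t ≤ 1, closedBall z t ⊆ closedBall 0 (R + 1) := fun t ht =>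
      closedBall_subset_closedBall' (by rw [dist_zero_right, hzn]; linarith)
    have h1 := lintegral_ball_ge (u := fun w => ENNReal.ofReal (v w)) (hvm.ennreal_ofReal) (z := z)
      (c := ENNReal.ofReal (2 * π * log⁺ ‖F z‖)) (fun t ht => by
        rw [havg z t ht.1 (hsub t ht.2.le)]
        gcongr
        exact posLog_norm_le_circleAverage ht.1 fun w hw => hF w (hsub t ht.2.le hw))
    have h2 := lintegral_annulus_le (u := fun w => ENNReal.ofReal (v w)) (hvm.ennreal_ofReal)
      (R := R) (by linarith) (m := ENNReal.ofReal (2 * π * M)) (fun t ht => by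
        rw [havg 0 t (by linarith [ht.1]) (closedBall_subset_closedBall ht.2.le)]
        gcongr
        exact hM t ht)
    have h3 : ∫⁻ w in ball z 1, ENNReal.ofReal (v w) ≤
        ∫⁻ w in {w : ℂ | ‖w‖ ∈ Ioo (R - 1) (R + 1)}, ENNReal.ofReal (v w) := by
      refine lintegral_mono_set fun w hw => ?_
      have hw' : ‖w - z‖ < 1 := by simpa [dist_eq_norm] using hw
      have a1 := norm_sub_norm_le w z
      have a2 := norm_sub_norm_le z w
      rw [norm_sub_rev z w] at a2
      exact ⟨by linarith, by linarith⟩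
    have h4 := h1.trans (h3.trans h2)
    rw [← ENNReal.ofReal_mul (by norm_num), ← ENNReal.ofReal_mul (by linarith),
      ENNReal.ofReal_le_ofReal_iff (by positivity)] at h4
    have h5 : log⁺ ‖F z‖ ≤ 4 * R * M := by
      have := pi_pos
      by_contra hcon
      push Not at hcon
      nlinarith
    rcases eq_or_ne (F z) 0 with h0 | h0
    · rw [h0, norm_zero]; positivity
    · rw [← Real.log_le_iff_le_exp (norm_pos_iff.2 h0)]
      exact (le_max_right _ _).trans (by rwa [posLog_apply] at h5)
  intro z hz
  refine Complex.norm_le_of_forall_mem_frontier_norm_le (U := ball 0 R) isBounded_ball ?_ ?_ ?_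
  · refine DifferentiableOn.diffContOnCl ?_
    rw [closure_ball _ (by linarith)]
    exact (hF.mono (closedBall_subset_closedBall (by linarith))).differentiableOn
  · rw [frontier_ball _ (by linarith)]; exact hsphere
  · rwa [closure_ball _ (by linarith)]

/-! ### Quotients of analytic functions by products of linear factors. -/

/-- The product of the linear factors `z - a` with `a` in the multiset `s`. -/
noncomputable def linProd (s : Multiset ℂ) (z : ℂ) : ℂ := (s.map (z - ·)).prod

@[simp] theorem linProd_zero (z : ℂ) : linProd 0 z = 1 := by simp [linProd]

@[simp] theorem linProd_cons (a : ℂ) (s : Multiset ℂ) (z : ℂ) :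
    linProd (a ::ₘ s) z = (z - a) * linProd s z := by simp [linProd]

theorem linProd_add (s t : Multiset ℂ) (z : ℂ) :
    linProd (s + t) z = linProd s z * linProd t z := by simp [linProd]

theorem differentiable_linProd (s : Multiset ℂ) : Differentiable ℂ (linProd s) := by
  induction s using Multiset.induction with
  | empty =>
    have : linProd 0 = fun _ => 1 := funext linProd_zero
    rw [this]; fun_prop
  | cons a s ih =>
    have : linProd (a ::ₘ s) = fun z => (z - a) * linProd s z := funext (linProd_cons a s)
    rw [this]; fun_prop

theorem linProd_eventually_ne_zero (s : Multiset ℂ) (z : ℂ) : ∀ᶠ w in 𝓝[≠] z, linProd s w ≠ 0 := by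
  induction s using Multiset.induction with
  | empty => simp
  | cons a s ih =>
    have h1 : ∀ᶠ w in 𝓝[≠] z, w ≠ a := by
      rcases eq_or_ne z a with rfl | h
      · exact eventually_mem_nhdsWithin
      · exact (eventually_ne_nhds h).filter_mono nhdsWithin_le_nhds
    filter_upwards [ih, h1] with w hw hwa
    rw [linProd_cons]
    exact mul_ne_zero (sub_ne_zero.2 hwa) hw

theorem add_exp_le_exp_add {x y : ℝ} (hx : 0 ≤ x) (hy : 0 ≤ y) :
    x + rexp y ≤ rexp (x + y) := by
  rw [Real.exp_add]
  have h1 := Real.add_one_le_exp x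
  have h2 := Real.one_le_exp hy
  nlinarith [mul_nonneg (by linarith : 0 ≤ rexp x - 1) (by linarith : 0 ≤ rexp y - 1)]

theorem two_mul_exp_le {x y : ℝ} (h : 1 + x ≤ y) : rexp x + rexp x ≤ rexp y := by
  refine le_trans ?_ (Real.exp_le_exp.2 h)
  rw [Real.exp_add]
  have := Real.add_one_le_exp (1 : ℝ)
  nlinarith [Real.exp_pos x]

theorem norm_sub_le_exp {R M : ℝ} (hM : 0 ≤ M) {a z : ℂ} (ha : ‖a‖ ≤ rexp M) (hz : ‖z‖ ≤ R) :
    ‖z - a‖ ≤ rexp (R + M) :=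
  (norm_sub_le _ _).trans ((add_le_add hz ha).trans (add_exp_le_exp_add ((norm_nonneg z).trans hz) hM))

theorem norm_linProd_le {R M N : ℝ} (hM : 0 ≤ M) (s : Multiset ℂ)
    (hs : ∀ a ∈ s, ‖a‖ ≤ rexp M) (hc : (s.card : ℝ) ≤ N) {z : ℂ} (hz : ‖z‖ ≤ R) :
    ‖linProd s z‖ ≤ rexp (N * (R + M)) := by
  have hR : 0 ≤ R := (norm_nonneg z).trans hz
  have : ‖linProd s z‖ ≤ rexp (s.card * (R + M)) := by
    clear hc
    induction s using Multiset.induction with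
    | empty => simp
    | cons a s ih =>
      rw [linProd_cons, norm_mul, Multiset.card_cons]
      calc _ ≤ rexp (R + M) * rexp (s.card * (R + M)) := by
            gcongr
            · exact norm_sub_le_exp hM (hs a (Multiset.mem_cons_self a s)) hz
            · exact ih fun b hb => hs b (Multiset.mem_cons_of_mem hb)
        _ = _ := by rw [← Real.exp_add]; push_cast; ring_nf
  exact this.trans (by gcongr)

/-- On the disc of radius `R`, the function `f` is a quotient `F / ∏ (z - a)` of an analytic function
`F` by a product of linear factors, with quantitative bounds in terms of `M`. -/
def IsQuotient (f : ℂ → ℂ) (R M : ℝ) : Prop :=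
  ∃ (F : ℂ → ℂ) (s : Multiset ℂ), DifferentiableOn ℂ F (ball 0 R) ∧
    (∀ z ∈ ball (0 : ℂ) R, ‖F z‖ ≤ rexp M) ∧ (s.card : ℝ) ≤ M ∧ (∀ a ∈ s, ‖a‖ ≤ rexp M) ∧
    ∀ z ∈ ball (0 : ℂ) R, f =ᶠ[𝓝[≠] z] fun w => F w / linProd s w

namespace IsQuotient
variable {f g : ℂ → ℂ} {R M : ℝ}

theorem mono {M' : ℝ} (h : IsQuotient f R M) (hM : M ≤ M') : IsQuotient f R M' := by
  obtain ⟨F, s, h1, h2, h3, h4, h5⟩ := h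
  exact ⟨F, s, h1, fun z hz => (h2 z hz).trans (by gcongr), h3.trans hM,
    fun a ha => (h4 a ha).trans (by gcongr), h5⟩

theorem nonneg (h : IsQuotient f R M) : 0 ≤ M := by
  obtain ⟨F, s, h1, h2, h3, h4, h5⟩ := h
  exact (Nat.cast_nonneg _).trans h3

theorem congr (h : IsQuotient f R M) (hfg : ∀ z, f =ᶠ[𝓝[≠] z] g) : IsQuotient g R M := by
  obtain ⟨F, s, h1, h2, h3, h4, h5⟩ := h
  exact ⟨F, s, h1, h2, h3, h4, fun z hz => (hfg z).symm.trans (h5 z hz)⟩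

theorem const (c : ℂ) (hM : ‖c‖ ≤ M) : IsQuotient (fun _ => c) R M :=
  ⟨fun _ => c, 0, by fun_prop,
    fun z _ => hM.trans (by linarith [Real.add_one_le_exp M]),
    by simpa using (norm_nonneg c).trans hM, by simp, fun z _ => by simp⟩

theorem mul (hf : IsQuotient f R M) (hg : IsQuotient g R M) :
    IsQuotient (fun z => f z * g z) R (2 * M) := by
  have hM := hf.nonneg
  obtain ⟨F, s, h1, h2, h3, h4, h5⟩ := hf
  obtain ⟨G, t, k1, k2, k3, k4, k5⟩ := hg
  refine ⟨fun z => F z * G z, s + t, h1.mul k1, fun z hz => ?_, ?_, fun a ha => ?_, fun z hz => ?_⟩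
  · rw [norm_mul, two_mul, Real.exp_add]
    gcongr
    exacts [h2 z hz, k2 z hz]
  · rw [Multiset.card_add]; push_cast; linarith
  · refine le_trans ?_ (Real.exp_le_exp.2 (by linarith : M ≤ 2 * M))
    rcases Multiset.mem_add.1 ha with ha | ha
    exacts [h4 a ha, k4 a ha]
  · filter_upwards [h5 z hz, k5 z hz] with w hw hw'
    rw [hw, hw', linProd_add, div_mul_div_comm]

theorem add (hR : 0 ≤ R) (hf : IsQuotient f R M) (hg : IsQuotient g R M) :
    IsQuotient (fun z => f z + g z) R (1 + 2 * M + M * (R + M)) := by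
  have hM := hf.nonneg
  obtain ⟨F, s, h1, h2, h3, h4, h5⟩ := hf
  obtain ⟨G, t, k1, k2, k3, k4, k5⟩ := hg
  have hMM : 0 ≤ M * (R + M) := by positivity
  refine ⟨fun z => F z * linProd t z + G z * linProd s z, s + t,
    (h1.mul (differentiable_linProd t).differentiableOn).add
      (k1.mul (differentiable_linProd s).differentiableOn), fun z hz => ?_, ?_, fun a ha => ?_,
      fun z hz => ?_⟩
  · have hz' : ‖z‖ ≤ R := by simpa using (mem_ball_zero_iff.1 hz).le
    refine (norm_add_le _ _).trans ?_
    rw [norm_mul, norm_mul]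
    refine le_trans (add_le_add (b := rexp (M + M * (R + M))) (d := rexp (M + M * (R + M))) ?_ ?_)
      (two_mul_exp_le (by linarith))
    · rw [Real.exp_add]
      gcongr
      exacts [h2 z hz, norm_linProd_le hM t k4 k3 hz']
    · rw [Real.exp_add]
      gcongr
      exacts [k2 z hz, norm_linProd_le hM s h4 h3 hz']
  · rw [Multiset.card_add]; push_cast; linarith
  · refine le_trans ?_ (Real.exp_le_exp.2 (by linarith : M ≤ _))
    rcases Multiset.mem_add.1 ha with ha | ha
    exacts [h4 a ha, k4 a ha]
  · filter_upwards [h5 z hz, k5 z hz, linProd_eventually_ne_zero s z,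
      linProd_eventually_ne_zero t z] with w hw hw' hs ht
    rw [hw, hw', linProd_add]
    field_simp

theorem comp_add_const (c : ℂ) {k : ℝ} (hc : ‖c‖ ≤ k) (hf : IsQuotient f (R + k) M) :
    IsQuotient (fun z => f (z + c)) R (M + k) := by
  have hM := hf.nonneg
  have hk : 0 ≤ k := (norm_nonneg c).trans hc
  obtain ⟨F, s, h1, h2, h3, h4, h5⟩ := hf
  have hmaps : ∀ z ∈ ball (0 : ℂ) R, z + c ∈ ball (0 : ℂ) (R + k) := fun z hz => by
    rw [mem_ball_zero_iff] at hz ⊢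
    exact (norm_add_le _ _).trans_lt (by linarith)
  refine ⟨fun z => F (z + c), s.map (· - c), ?_, fun z hz => ?_, ?_, fun a ha => ?_, fun z hz => ?_⟩
  · exact h1.comp (by fun_prop) hmaps
  · exact (h2 _ (hmaps z hz)).trans (by gcongr; linarith)
  · rw [Multiset.card_map]; linarith
  · obtain ⟨b, hb, rfl⟩ := Multiset.mem_map.1 ha
    rw [norm_sub_rev, add_comm]
    exact norm_sub_le_exp hM (h4 b hb) hc
  · have ht : Tendsto (fun w => w + c) (𝓝[≠] z) (𝓝[≠] (z + c)) := by
      refine tendsto_nhdsWithin_iff.2 ⟨?_, ?_⟩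
      · exact (Continuous.tendsto (by fun_prop) z).mono_left nhdsWithin_le_nhds
      · filter_upwards [self_mem_nhdsWithin] with w hw
        simpa using hw
    filter_upwards [ht.eventually (h5 _ (hmaps z hz))] with w hw
    rw [hw]
    simp [linProd, sub_sub_eq_add_sub]

/-- With S = `linProd s`, (F/S)' = (F'S - FS')/S². Cauchy's estimate on unit circles puts F' and S'
under the same bounds as F and S, at the price of one unit of radius. -/
theorem deriv (hR : 0 ≤ R) (hf : IsQuotient f (R + 1) M) :
    IsQuotient (deriv f) R (1 + 2 * M + M * (R + 1 + M)) := by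
  have hM := hf.nonneg
  obtain ⟨F, s, h1, h2, h3, h4, h5⟩ := hf
  have hball : ∀ z ∈ ball (0 : ℂ) R, closedBall z 1 ⊆ ball 0 (R + 1) := fun z hz =>
    closedBall_subset_ball' (by rw [mem_ball] at hz; linarith)
  have hsub : ball (0 : ℂ) R ⊆ ball 0 (R + 1) := ball_subset_ball (by linarith)
  have cauchy : ∀ (G : ℂ → ℂ) (K : ℝ), DifferentiableOn ℂ G (ball 0 (R + 1)) →
      (∀ z ∈ ball (0 : ℂ) (R + 1), ‖G z‖ ≤ K) → ∀ z ∈ ball (0 : ℂ) R, ‖_root_.deriv G z‖ ≤ K := by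
    intro G K hG hK z hz
    have := Complex.norm_deriv_le_of_forall_mem_sphere_norm_le (c := z) (R := 1) one_pos
      (f := G) (C := K) (DifferentiableOn.diffContOnCl (by
        rw [closure_ball _ one_ne_zero]; exact hG.mono (hball z hz)))
      fun w hw => hK w (hball z hz (sphere_subset_closedBall hw))
    simpa using this
  have hP : ∀ z ∈ ball (0 : ℂ) (R + 1), ‖linProd s z‖ ≤ rexp (M * (R + 1 + M)) := fun z hz =>
    norm_linProd_le hM s h4 h3 (mem_ball_zero_iff.1 hz).le
  have hMM : 0 ≤ M * (R + 1 + M) := by positivity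
  refine ⟨fun z => _root_.deriv F z * linProd s z - F z * _root_.deriv (linProd s) z, s + s, ?_,
    fun z hz => ?_, ?_, fun a ha => ?_, fun z hz => ?_⟩
  · exact (((h1.deriv isOpen_ball).mono hsub).mul (differentiable_linProd s).differentiableOn).sub
      ((h1.mono hsub).mul ((differentiable_linProd s).differentiableOn.deriv isOpen_ball))
  · refine (norm_sub_le _ _).trans ?_
    rw [norm_mul, norm_mul]
    refine le_trans (add_le_add (b := rexp (M + M * (R + 1 + M)))
      (d := rexp (M + M * (R + 1 + M))) ?_ ?_) (two_mul_exp_le (by linarith))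
    · rw [Real.exp_add]
      gcongr
      exacts [cauchy F _ h1 h2 z hz, hP z (hsub hz)]
    · rw [Real.exp_add]
      gcongr
      exacts [h2 z (hsub hz), cauchy _ _ (differentiable_linProd s).differentiableOn hP z hz]
  · rw [Multiset.card_add]; push_cast; linarith
  · refine (h4 a ?_).trans (Real.exp_le_exp.2 ?_)
    · simpa using ha
    · linarith
  · have hne := (linProd_eventually_ne_zero s z)
    have hmem : ∀ᶠ w in 𝓝[≠] z, w ∈ ball (0 : ℂ) (R + 1) :=
      nhdsWithin_le_nhds (isOpen_ball.mem_nhds (hsub hz))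
    filter_upwards [(h5 z (hsub hz)).nhdsNE_deriv, hne, hmem] with w hw hw0 hwm
    rw [hw, deriv_fun_div (h1.differentiableAt (isOpen_ball.mem_nhds hwm))
      (differentiable_linProd s w) hw0, linProd_add, pow_two]

end IsQuotient

theorem eventuallyEq_codiscreteWithin_of_forall {f g : ℂ → ℂ} {U : Set ℂ}
    (h : ∀ z ∈ U, f =ᶠ[𝓝[≠] z] g) : f =ᶠ[codiscreteWithin U] g := by
  rw [Filter.EventuallyEq, Filter.Eventually, mem_codiscreteWithin_iff_forall_mem_nhdsNE]
  intro z hz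
  exact mem_of_superset (h z hz) subset_union_left

theorem eventuallyEq_codiscrete_iff {f g : ℂ → ℂ} :
    f =ᶠ[codiscrete ℂ] g ↔ ∀ z, f =ᶠ[𝓝[≠] z] g := by
  rw [Filter.EventuallyEq, Filter.Eventually, codiscrete,
    mem_codiscreteWithin_iff_forall_mem_nhdsNE]
  simp [Filter.EventuallyEq, Filter.Eventually]

/-- Since log⁺(1/x) = log⁺ x - log x, it suffices that the average of log|w - a| is log R +
log⁺(|a|/R) ≥ 0. The bound therefore holds however close a is to the circle. -/
theorem circleAverage_posLog_inv_sub_le {R M : ℝ} (hR : 1 ≤ R) (hM : 0 ≤ M) {a : ℂ}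
    (ha : ‖a‖ ≤ rexp M) :
    circleAverage (fun w => log⁺ ‖(w - a)⁻¹‖) 0 R ≤ R + M := by
  have hRa : |R| = R := abs_of_pos (by linarith)
  have hm : MeromorphicOn (fun w : ℂ => w - a) (sphere 0 |R|) := fun x _ => by fun_prop
  have h1 : (fun w : ℂ => log⁺ ‖(w - a)⁻¹‖) =
      fun w => log⁺ ‖w - a‖ - Real.log ‖w - a‖ := by
    funext w
    rw [norm_inv, ← posLog_sub_posLog_inv]; ring
  rw [h1, circleAverage_fun_sub hm.circleIntegrable_posLog_norm hm.circleIntegrable_log_norm,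
    circleAverage_log_norm_sub_const_eq_log_radius_add_posLog (by linarith)]
  have h2 : circleAverage (fun w => log⁺ ‖w - a‖) 0 R ≤ R + M := by
    refine circleAverage_mono_on_of_le_circle hm.circleIntegrable_posLog_norm fun w hw => ?_
    have hw' : ‖w‖ ≤ R := by simpa [hRa] using (mem_sphere_iff_norm.1 hw).le
    refine (posLog_le_posLog (norm_nonneg _) (norm_sub_le_exp hM ha hw')).trans ?_
    rw [posLog_apply, Real.log_exp]
    exact max_le (by linarith) le_rfl
  have h3 := Real.log_nonneg hR
  have h4 : 0 ≤ log⁺ (R⁻¹ * ‖0 - a‖) := posLog_nonneg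
  linarith

theorem circleAverage_posLog_div_linProd_le {R M : ℝ} (hR : 1 ≤ R) (hM : 0 ≤ M) {F : ℂ → ℂ}
    (hF : MeromorphicOn F (sphere 0 |R|)) (s : Multiset ℂ) (hs : ∀ a ∈ s, ‖a‖ ≤ rexp M) :
    circleAverage (fun w => log⁺ ‖F w / linProd s w‖) 0 R ≤
      circleAverage (fun w => log⁺ ‖F w‖) 0 R + s.card * (R + M) := by
  have hl : ∀ t : Multiset ℂ, MeromorphicOn (linProd t) (sphere 0 |R|) := fun t x _ =>
    ((differentiable_linProd t).analyticAt x).meromorphicAt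
  induction s using Multiset.induction with
  | empty => simp
  | cons a s ih =>
    have ih' := ih fun b hb => hs b (Multiset.mem_cons_of_mem hb)
    have ha := circleAverage_posLog_inv_sub_le hR hM (hs a (Multiset.mem_cons_self a s))
    have hma : MeromorphicOn (fun w : ℂ => (w - a)⁻¹) (sphere 0 |R|) := fun x _ => by fun_prop
    have hmd : MeromorphicOn (fun w => F w / linProd s w) (sphere 0 |R|) := hF.div (hl s)
    have hmc : MeromorphicOn (fun w => F w / linProd (a ::ₘ s) w) (sphere 0 |R|) := hF.div (hl _)
    calc circleAverage (fun w => log⁺ ‖F w / linProd (a ::ₘ s) w‖) 0 R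
        ≤ circleAverage (fun w => log⁺ ‖F w / linProd s w‖ + log⁺ ‖(w - a)⁻¹‖) 0 R := by
          refine circleAverage_mono hmc.circleIntegrable_posLog_norm
            (hmd.circleIntegrable_posLog_norm.add hma.circleIntegrable_posLog_norm) fun w _ => ?_
          have : F w / linProd (a ::ₘ s) w = F w / linProd s w * (w - a)⁻¹ := by
            rw [linProd_cons, mul_comm, div_mul_eq_div_div, div_eq_mul_inv (F w / _)]
          rw [this, norm_mul]
          exact posLog_mul
      _ ≤ _ := by
        rw [circleAverage_fun_add hmd.circleIntegrable_posLog_norm hma.circleIntegrable_posLog_norm,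
          Multiset.card_cons]
        push_cast
        linarith

theorem IsQuotient.circleAverage_posLog_le {f : ℂ → ℂ} {R M : ℝ} (hR : 1 ≤ R)
    (hf : IsQuotient f (R + 1) M) :
    circleAverage (fun w => log⁺ ‖f w‖) 0 R ≤ M + M * (R + M) := by
  have hM := hf.nonneg
  have hRa : |R| = R := abs_of_pos (by linarith)
  obtain ⟨F, s, h1, h2, h3, h4, h5⟩ := hf
  have hsub : sphere (0 : ℂ) |R| ⊆ ball 0 (R + 1) := by
    rw [hRa]; exact sphere_subset_closedBall.trans (closedBall_subset_ball (by linarith))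
  have hF : MeromorphicOn F (sphere 0 |R|) := fun x hx =>
    (h1.analyticAt (isOpen_ball.mem_nhds (hsub hx))).meromorphicAt
  have hEq : (fun w => log⁺ ‖f w‖) =ᶠ[codiscreteWithin (sphere 0 |R|)]
      fun w => log⁺ ‖F w / linProd s w‖ := by
    filter_upwards [eventuallyEq_codiscreteWithin_of_forall fun z hz => h5 z (hsub hz)] with w hw
    rw [hw]
  rw [circleAverage_congr_codiscreteWithin hEq (by linarith)]
  refine (circleAverage_posLog_div_linProd_le hR hM hF s h4).trans (add_le_add ?_ ?_)
  · refine circleAverage_mono_on_of_le_circle hF.circleIntegrable_posLog_norm fun w hw => ?_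
    refine (posLog_le_posLog (norm_nonneg _) (h2 w (hsub hw))).trans ?_
    rw [posLog_apply, Real.log_exp]
    exact max_le hM le_rfl
  · gcongr

/-! ### Tame functions and their closure properties. -/

/-- Functions that are, on each disc of radius `R ≥ 1`, quotients with polynomial bounds in `R`. -/
def IsTame (f : ℂ → ℂ) : Prop :=
  ∃ p : ℕ[X], ∀ R : ℝ, 1 ≤ R → IsQuotient f R (aeval R p)

/-- Coefficients in ℕ make every bound nonnegative and monotone on [0, ∞), and keep bounds closed
under sum, product and composition. -/
theorem aeval_nonneg_of_nonneg (p : ℕ[X]) {x : ℝ} (hx : 0 ≤ x) : 0 ≤ aeval x p := by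
  rw [aeval_eq_sum_range]
  exact Finset.sum_nonneg fun i _ => by positivity

theorem aeval_mono_of_nonneg (p : ℕ[X]) {x y : ℝ} (hx : 0 ≤ x) (hxy : x ≤ y) :
    aeval x p ≤ aeval y p := by
  rw [aeval_eq_sum_range, aeval_eq_sum_range]
  exact Finset.sum_le_sum fun i _ => by gcongr

theorem aeval_le_mul_pow (p : ℕ[X]) {x : ℝ} (hx : 1 ≤ x) :
    aeval x p ≤ aeval (1 : ℝ) p * x ^ p.natDegree := by
  rw [aeval_eq_sum_range, aeval_eq_sum_range, Finset.sum_mul]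
  refine Finset.sum_le_sum fun i hi => ?_
  rw [one_pow, smul_mul_assoc, one_mul]
  gcongr
  exact Nat.lt_succ_iff.1 (Finset.mem_range.1 hi)

namespace IsTame
variable {f g : ℂ → ℂ}

theorem congr (hf : IsTame f) (hfg : ∀ z, f =ᶠ[𝓝[≠] z] g) : IsTame g :=
  hf.imp fun _ h R hR => (h R hR).congr hfg

theorem const (c : ℂ) : IsTame fun _ => c :=
  ⟨C ⌈‖c‖⌉₊, fun R _ => IsQuotient.const c (by simpa using Nat.le_ceil ‖c‖)⟩

theorem exists_common (hf : IsTame f) (hg : IsTame g) :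
    ∃ p : ℕ[X], ∀ R : ℝ, 1 ≤ R → IsQuotient f R (aeval R p) ∧ IsQuotient g R (aeval R p) := by
  obtain ⟨p, hp⟩ := hf
  obtain ⟨q, hq⟩ := hg
  refine ⟨p + q, fun R hR => ?_⟩
  have h1 := aeval_nonneg_of_nonneg p (zero_le_one.trans hR)
  have h2 := aeval_nonneg_of_nonneg q (zero_le_one.trans hR)
  rw [map_add]
  exact ⟨(hp R hR).mono (by linarith), (hq R hR).mono (by linarith)⟩

theorem add (hf : IsTame f) (hg : IsTame g) : IsTame fun z => f z + g z := by
  obtain ⟨p, hp⟩ := hf.exists_common hg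
  refine ⟨1 + (p + p) + p * (X + p), fun R hR => ?_⟩
  simpa [two_mul] using (hp R hR).1.add (by linarith) (hp R hR).2

theorem mul (hf : IsTame f) (hg : IsTame g) : IsTame fun z => f z * g z := by
  obtain ⟨p, hp⟩ := hf.exists_common hg
  refine ⟨p + p, fun R hR => ?_⟩
  simpa [two_mul] using (hp R hR).1.mul (hp R hR).2

theorem sum {ι : Type*} (s : Finset ι) {F : ι → ℂ → ℂ} (h : ∀ i ∈ s, IsTame (F i)) :
    IsTame fun z => ∑ i ∈ s, F i z := by
  classical
  induction s using Finset.induction with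
  | empty => simpa using const 0
  | insert i s hi ih =>
    simp only [Finset.sum_insert hi]
    exact (h i (Finset.mem_insert_self i s)).add (ih fun j hj => h j (Finset.mem_insert_of_mem hj))

theorem comp_add_const (hf : IsTame f) (c : ℂ) : IsTame fun z => f (z + c) := by
  obtain ⟨p, hp⟩ := hf
  refine ⟨p.comp (X + C ⌈‖c‖⌉₊) + C ⌈‖c‖⌉₊, fun R hR => ?_⟩
  have h0 : (0 : ℝ) ≤ ⌈‖c‖⌉₊ := Nat.cast_nonneg _
  simpa [aeval_comp] using (hp (R + ⌈‖c‖⌉₊) (by linarith)).comp_add_const c (Nat.le_ceil ‖c‖)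

theorem deriv (hf : IsTame f) : IsTame (deriv f) := by
  obtain ⟨p, hp⟩ := hf
  refine ⟨1 + (p.comp (X + 1) + p.comp (X + 1)) + p.comp (X + 1) * (X + 1 + p.comp (X + 1)), fun R hR => ?_⟩
  simpa [aeval_comp, two_mul] using (hp (R + 1) (by linarith)).deriv (by linarith)

theorem iteratedDeriv (hf : IsTame f) (k : ℕ) : IsTame (iteratedDeriv k f) := by
  induction k with
  | zero => simpa using hf
  | succ k ih => rw [iteratedDeriv_succ]; exact ih.deriv

theorem exists_circleAverage_posLog_le (hf : IsTame f) :
    ∃ p : ℕ[X], ∀ R : ℝ, 1 ≤ R → circleAverage (fun w => log⁺ ‖f w‖) 0 R ≤ aeval R p := by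
  obtain ⟨p, hp⟩ := hf
  refine ⟨p.comp (X + 1) + p.comp (X + 1) * (X + p.comp (X + 1)), fun R hR => ?_⟩
  simpa [aeval_comp] using (hp (R + 1) (by linarith)).circleAverage_posLog_le hR

end IsTame

theorem IsTame.diffPoly {f : ℂ → ℂ} (hf : IsTame f) (n : ℕ) (a : ℕ → ℂ) (c : ℂ) :
    IsTame (diffPoly n a c f) :=
  IsTame.sum _ fun j _ => (IsTame.const (a j)).mul (hf.comp_add_const (j * c))

theorem IsTame.derivPoly {f : ℂ → ℂ} (hf : IsTame f) (k : ℕ) (b : ℕ → ℂ) :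
    IsTame (derivPoly k b f) :=
  (IsTame.sum _ fun j _ => (IsTame.const (b j)).mul (hf.iteratedDeriv j)).add (IsTame.const (b 0))

/-! ### Cancelling poles: finite order implies tame. -/

/-- A point z ≠ 0 with |z| ≤ R has weight log(eR/|z|) ≥ 1 in the counting function at eR. The origin
enters only through `D 0 * Real.log r`: its summand in the finite sum contains `Real.log 0 = 0`. -/
theorem sum_le_logCounting {D : Function.locallyFinsupp ℂ ℤ} (hD : 0 ≤ D) {R : ℝ} (hR : 1 ≤ R)
    (S : Finset ℂ) (hS : ∀ z ∈ S, ‖z‖ ≤ R) :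
    ∑ z ∈ S, (D z : ℝ) ≤ Function.locallyFinsuppWithin.logCounting D (rexp 1 * R) := by
  classical
  have h1e : 1 ≤ rexp 1 := Real.one_le_exp zero_le_one
  set r := rexp 1 * R with hr
  have hRr : R ≤ r := by nlinarith
  have hr0 : 0 < r := by linarith
  have hD0 : ∀ z, (0 : ℝ) ≤ D z := fun z => by exact_mod_cast hD z
  set E := Function.locallyFinsuppWithin.toClosedBall r D with hE
  have hfin : E.support.Finite := E.finiteSupport (isCompact_closedBall 0 |r|)
  have hEz : ∀ z, ‖z‖ ≤ r → E z = D z := fun z hz =>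
    Function.locallyFinsuppWithin.toClosedBall_eval_within D (by simpa [abs_of_pos hr0] using hz)
  have hEout : ∀ z, ¬ ‖z‖ ≤ r → E z = 0 := fun z hz =>
    Function.locallyFinsuppWithin.apply_eq_zero_of_notMem E (by simpa [abs_of_pos hr0] using hz)
  have hterm : ∀ z, (0 : ℝ) ≤ E z * Real.log (r * ‖z‖⁻¹) := fun z => by
    by_cases hz : ‖z‖ ≤ r
    · rw [hEz z hz]
      refine mul_nonneg (hD0 z) ?_
      rcases eq_or_ne z 0 with rfl | h0
      · simp
      · have : 0 < ‖z‖ := norm_pos_iff.2 h0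
        refine Real.log_nonneg ?_
        rwa [← div_eq_mul_inv, le_div_iff₀ this, one_mul]
    · simp [hEout z hz]
  have hlogr : 1 ≤ Real.log r := by
    rw [hr, Real.log_mul (by positivity) (by positivity), Real.log_exp]
    linarith [Real.log_nonneg hR]
  have hsum : ∑ᶠ z, (E z : ℝ) * Real.log (r * ‖z‖⁻¹) =
      ∑ z ∈ hfin.toFinset ∪ S, (E z : ℝ) * Real.log (r * ‖z‖⁻¹) := by
    refine finsum_eq_sum_of_support_subset _ fun z hz => ?_
    have : E z ≠ 0 := fun h => hz (by simp [h])
    simp [this]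
  have hlc : Function.locallyFinsuppWithin.logCounting D r =
      ∑ᶠ z, (E z : ℝ) * Real.log (r * ‖z‖⁻¹) + D 0 * Real.log r := rfl
  rw [hlc, hsum]
  calc ∑ z ∈ S, (D z : ℝ)
      ≤ ∑ z ∈ S, ((E z : ℝ) * Real.log (r * ‖z‖⁻¹) + if z = 0 then (D 0 : ℝ) else 0) := by
        refine Finset.sum_le_sum fun z hz => ?_
        rcases eq_or_ne z 0 with rfl | h0
        · simp
        · have hz0 : 0 < ‖z‖ := norm_pos_iff.2 h0
          rw [if_neg h0, add_zero, hEz z ((hS z hz).trans hRr)]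
          refine le_mul_of_one_le_right (hD0 z) ?_
          rw [Real.le_log_iff_exp_le (by positivity), ← div_eq_mul_inv, le_div_iff₀ hz0, hr]
          gcongr
          exact hS z hz
    _ = ∑ z ∈ S, (E z : ℝ) * Real.log (r * ‖z‖⁻¹) + ∑ z ∈ S, if z = 0 then (D 0 : ℝ) else 0 :=
        Finset.sum_add_distrib
    _ ≤ _ := by
        refine add_le_add (Finset.sum_le_sum_of_subset_of_nonneg Finset.subset_union_right
          fun z _ _ => hterm z) ?_
        rw [Finset.sum_ite_eq']
        split_ifs
        · exact le_mul_of_one_le_right (hD0 0) hlogr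
        · exact mul_nonneg (hD0 0) (by linarith)

theorem meromorphicOrderAt_linProd (s : Multiset ℂ) (z : ℂ) :
    meromorphicOrderAt (linProd s) z = ((s.count z : ℕ) : ℤ) := by
  induction s using Multiset.induction with
  | empty =>
    have : linProd 0 = fun _ => 1 := funext linProd_zero
    rw [this, meromorphicOrderAt_const]
    simp
  | cons a s ih =>
    have h : linProd (a ::ₘ s) = (fun z => z - a) * linProd s := funext (linProd_cons a s)
    rw [h, meromorphicOrderAt_mul (by fun_prop)
      ((differentiable_linProd s).analyticAt z).meromorphicAt, ih, Multiset.count_cons]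
    rcases eq_or_ne z a with rfl | hza
    · have : meromorphicOrderAt (fun w => w - z) z = 1 := meromorphicOrderAt_id_sub_const
      rw [this, if_pos rfl, add_comm]
      norm_cast
    · have : meromorphicOrderAt (fun w => w - a) z = 0 := by
        have ha : AnalyticAt ℂ (fun w => w - a) z := by fun_prop
        rw [ha.meromorphicOrderAt_eq, ha.analyticOrderAt_eq_zero.2 (sub_ne_zero.2 hza)]
        rfl
      rw [this, if_neg hza, zero_add, add_zero]

/-- The poles of `f` in the disc of radius `R` can be cancelled by a product of linear factors, whose
number is bounded by the logarithmic counting function. -/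
theorem exists_poles_multiset {f : ℂ → ℂ} (hf : Meromorphic f) {R : ℝ} (hR : 1 ≤ R) :
    ∃ s : Multiset ℂ, (s.card : ℝ) ≤ logCounting f ⊤ (rexp 1 * R) ∧ (∀ a ∈ s, ‖a‖ ≤ R) ∧
      ∀ z ∈ closedBall (0 : ℂ) R, 0 ≤ meromorphicOrderAt (fun w => f w * linProd s w) z := by
  classical
  set D := (MeromorphicOn.divisor f univ)⁻ with hDdef
  have hD : 0 ≤ D := negPart_nonneg _
  have hfin : {z | z ∈ closedBall (0 : ℂ) R ∧ D z ≠ 0}.Finite := by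
    refine ((Function.locallyFinsuppWithin.toClosedBall R D).finiteSupport
      (isCompact_closedBall 0 |R|)).subset fun z hz => ?_
    rw [Function.mem_support, Function.locallyFinsuppWithin.toClosedBall_eval_within D
      (by simpa [abs_of_pos (zero_lt_one.trans_le hR)] using hz.1)]
    exact hz.2
  set S := hfin.toFinset with hS
  have hSR : ∀ z ∈ S, ‖z‖ ≤ R := fun z hz => by simpa using ((Finite.mem_toFinset hfin).1 hz).1
  refine ⟨∑ z ∈ S, (D z).toNat • {z}, ?_, fun a ha => ?_, fun z hz => ?_⟩
  · rw [logCounting_top]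
    refine le_trans (le_of_eq ?_) (sum_le_logCounting hD hR S hSR)
    rw [Multiset.card_sum, Nat.cast_sum]
    refine Finset.sum_congr rfl fun z _ => ?_
    have : ((D z).toNat : ℤ) = D z := Int.toNat_of_nonneg (hD z)
    simp only [Multiset.card_nsmul, Multiset.card_singleton, mul_one]
    exact_mod_cast this
  · obtain ⟨z, hz, haz⟩ := Multiset.mem_sum.1 ha
    have := Multiset.mem_of_mem_nsmul haz
    rw [Multiset.mem_singleton] at this
    rw [this]; exact hSR z hz
  · have hl := ((differentiable_linProd (∑ z ∈ S, (D z).toNat • {z})).analyticAt z).meromorphicAt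
    have := meromorphicOrderAt_mul (hf z) hl
    rw [show (fun w => f w * linProd (∑ z ∈ S, (D z).toNat • {z}) w) =
      f * linProd (∑ z ∈ S, (D z).toNat • {z}) from rfl, this, meromorphicOrderAt_linProd]
    have hcount : ((∑ z ∈ S, (D z).toNat • ({z} : Multiset ℂ)).count z : ℤ) = D z := by
      rw [Multiset.count_sum']
      simp only [Multiset.count_nsmul, Multiset.count_singleton, mul_ite, mul_one, mul_zero]
      rw [Finset.sum_ite_eq]
      split_ifs with h
      · exact Int.toNat_of_nonneg (hD z)
      · by_contra hne
        exact h ((Finite.mem_toFinset hfin).2 ⟨hz, fun h0 => hne (by simp [h0])⟩)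
    rw [hcount]
    have hDz : D z = max (-(meromorphicOrderAt f z).untop₀) 0 := by
      rw [hDdef, Function.locallyFinsuppWithin.negPart_apply,
        MeromorphicOn.divisor_apply hf.meromorphicOn (mem_univ z)]
      rfl
    rw [hDz]
    cases h : meromorphicOrderAt f z with
    | top => simp
    | coe n =>
      rw [WithTop.untop₀_coe]
      norm_cast
      have := le_max_left (-n) 0
      linarith

/-- Multiplying f by the linear factors at its poles leaves an analytic F whose proximity function
is at most that of f plus the cost of the factors; `norm_le_exp_of_circleAverage_le` turns this
average into a pointwise bound. -/
theorem isTame_of_characteristic_le {f : ℂ → ℂ} (hf : Meromorphic f) {p : ℕ[X]}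
    (hp : ∀ r : ℝ, 1 ≤ r → characteristic f ⊤ r ≤ aeval r p) : IsTame f := by
  -- Poles are cancelled up to radius R + 2, since bounding F at radius R + 1 uses circles up to R +
  -- 2. Their number is controlled by the characteristic at e(R + 2), and e ≤ 3.
  set q := p.comp (3 * (X + 2)) with hq
  refine ⟨4 * (X + 1) * (q + q * (X + 2 + (X + 2))) + q + (X + 2), fun R hR => ?_⟩
  have hqR : aeval R q = aeval (3 * (R + 2)) p := by
    rw [hq, aeval_comp]; simp [map_ofNat]
  obtain ⟨s, hs1, hs2, hs3⟩ := exists_poles_multiset hf (R := R + 2) (by linarith)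
  have hT : ∀ r : ℝ, 1 ≤ r → r ≤ 3 * (R + 2) → characteristic f ⊤ r ≤ aeval R q := fun r h1 h2 => by
    rw [hqR]; exact (hp r h1).trans (aeval_mono_of_nonneg p (by linarith) h2)
  have he : 1 ≤ rexp 1 := Real.one_le_exp zero_le_one
  have he3 : rexp 1 ≤ 3 := by linarith [Real.exp_one_lt_d9]
  have hcard : (s.card : ℝ) ≤ aeval R q := by
    have h1 : 1 ≤ rexp 1 * (R + 2) := by nlinarith
    refine hs1.trans (le_trans ?_ (hT _ h1 (by gcongr)))
    rw [characteristic, Pi.add_apply]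
    exact le_add_of_nonneg_left (proximity_nonneg (rexp 1 * (R + 2)))
  have hq0 : 0 ≤ aeval R q := (Nat.cast_nonneg _).trans hcard
  have hroot : ∀ a ∈ s, ‖a‖ ≤ rexp (R + 2) := fun a ha =>
    (hs2 a ha).trans (by linarith [Real.add_one_le_exp (R + 2)])
  have hG : Meromorphic fun w => f w * linProd s w := fun z =>
    (hf z).mul ((differentiable_linProd s).analyticAt z).meromorphicAt
  set F := toMeromorphicNFOn (fun w => f w * linProd s w) univ with hF
  have hFG : ∀ z, (fun w => f w * linProd s w) =ᶠ[𝓝[≠] z] F := fun z =>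
    (hG.meromorphicOn.toMeromorphicNFOn_eq_self_on_nhdsNE (mem_univ z)).symm
  have hFan : AnalyticOnNhd ℂ F (closedBall 0 (R + 2)) := fun z hz => by
    rw [← ((meromorphicNFOn_toMeromorphicNFOn _ univ)
      (mem_univ z)).meromorphicOrderAt_nonneg_iff_analyticAt,
      meromorphicOrderAt_toMeromorphicNFOn hG.meromorphicOn (mem_univ z)]
    exact hs3 z hz
  have hbound : ∀ z ∈ closedBall (0 : ℂ) (R + 1), ‖F z‖ ≤
      rexp (4 * (R + 1) * (aeval R q + aeval R q * (R + 2 + (R + 2)))) := by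
    refine norm_le_exp_of_circleAverage_le (by linarith)
      (hFan.mono (closedBall_subset_closedBall (by linarith))) fun t ht => ?_
    have ht0 : t ≠ 0 := by linarith [ht.1]
    have htR : |t| ≤ R + 2 := by rw [abs_of_pos (by linarith [ht.1])]; linarith [ht.2]
    have hEq : (fun w => log⁺ ‖F w‖) =ᶠ[codiscreteWithin (sphere 0 |t|)]
        fun w => log⁺ ‖f w * linProd s w‖ := by
      filter_upwards [eventuallyEq_codiscreteWithin_of_forall fun z _ => hFG z] with w hw
      rw [hw]
    have hfi := hf.meromorphicOn.circleIntegrable_posLog_norm (c := 0) (R := t)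
    have hGi := hG.meromorphicOn.circleIntegrable_posLog_norm (c := 0) (R := t)
    rw [circleAverage_congr_codiscreteWithin hEq ht0]
    calc circleAverage (fun w => log⁺ ‖f w * linProd s w‖) 0 t
        ≤ circleAverage (fun w => log⁺ ‖f w‖ + aeval R q * (R + 2 + (R + 2))) 0 t := by
          refine circleAverage_mono hGi (hfi.add (circleIntegrable_const _ _ _)) fun w hw => ?_
          rw [norm_mul]
          refine posLog_mul.trans (add_le_add le_rfl ?_)
          have hw' : ‖w‖ ≤ R + 2 := by
            rw [mem_sphere_iff_norm, sub_zero] at hw; rw [hw]; exact htR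
          refine (posLog_le_posLog (norm_nonneg _)
            (norm_linProd_le (by linarith) s hroot hcard hw')).trans ?_
          rw [posLog_apply, Real.log_exp]
          exact max_le (by positivity) le_rfl
      _ ≤ _ := by
          rw [circleAverage_fun_add hfi (circleIntegrable_const _ _ _), circleAverage_const]
          refine add_le_add (le_trans ?_ (hT t (by linarith [ht.1]) (by linarith [ht.2]))) le_rfl
          rw [characteristic, Pi.add_apply, proximity_top]
          linarith [logCounting_nonneg (f := f) (e := ⊤) (r := t) (by linarith [ht.1])]
  have hM : aeval R (4 * (X + 1) * (q + q * (X + 2 + (X + 2))) + q + (X + 2) : ℕ[X]) =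
      4 * (R + 1) * (aeval R q + aeval R q * (R + 2 + (R + 2))) + aeval R q + (R + 2) := by
    simp [map_ofNat]
  have hpos : 0 ≤ 4 * (R + 1) * (aeval R q + aeval R q * (R + 2 + (R + 2))) := by positivity
  rw [hM]
  refine ⟨F, s, ?_, fun z hz => ?_, by linarith, fun a ha => ?_, fun z hz => ?_⟩
  · exact (hFan.mono (ball_subset_closedBall.trans
      (closedBall_subset_closedBall (by linarith)))).differentiableOn
  · exact (hbound z (ball_subset_closedBall.trans
      (closedBall_subset_closedBall (by linarith)) hz)).trans (Real.exp_le_exp.2 (by linarith))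
  · exact (hroot a ha).trans (Real.exp_le_exp.2 (by linarith))
  · filter_upwards [hFG z, linProd_eventually_ne_zero s z] with w hw hw0
    rw [← hw, mul_div_cancel_right₀ _ hw0]

/-- For a real x above the order, T(r, f) ≤ r^⌈x⌉ for large r; monotonicity of T covers the
remaining bounded range by a constant. -/
theorem exists_characteristic_le_of_growthOrder_ne_top {f : ℂ → ℂ} (hf : Meromorphic f)
    (h : growthOrder f ≠ ⊤) :
    ∃ p : ℕ[X], ∀ r : ℝ, 1 ≤ r → characteristic f ⊤ r ≤ aeval r p := by
  obtain ⟨x, hx, -⟩ := EReal.lt_iff_exists_real_btwn.1 (lt_top_iff_ne_top.2 h)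
  have hev := eventually_lt_of_limsup_lt hx
  obtain ⟨r₀, hr₀⟩ := eventually_atTop.1 hev
  set K := ⌈x⌉₊ with hK
  set r₁ := max r₀ (rexp 1) with hr₁
  have h1e : 1 ≤ rexp 1 := Real.one_le_exp zero_le_one
  have hlarge : ∀ r, r₁ ≤ r → characteristic f ⊤ r ≤ r ^ K := fun r hr => by
    have hre : rexp 1 ≤ r := (le_max_right _ _).trans hr
    have hr0 : 0 < r := by linarith
    have hlog : 1 ≤ Real.log r := by rwa [Real.le_log_iff_exp_le hr0]
    have h1 : log⁺ (characteristic f ⊤ r) / Real.log r < x := by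
      exact_mod_cast hr₀ r ((le_max_left _ _).trans hr)
    rw [div_lt_iff₀ (by linarith)] at h1
    have h2 : log⁺ (characteristic f ⊤ r) ≤ Real.log (r ^ K) := by
      rw [Real.log_pow]
      refine h1.le.trans ?_
      gcongr
      exact Nat.le_ceil x
    rcases le_or_gt (characteristic f ⊤ r) 0 with h0 | h0
    · exact h0.trans (by positivity)
    · rw [← Real.log_le_log_iff h0 (by positivity)]
      exact (le_max_right _ _).trans (by rwa [posLog_apply] at h2)
  refine ⟨C ⌈characteristic f ⊤ r₁⌉₊ + X ^ K, fun r hr => ?_⟩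
  simp only [map_add, map_pow, aeval_X, eq_natCast]
  have hpow : 0 ≤ r ^ K := by positivity
  rcases le_total r₁ r with hle | hle
  · have h0 : (0 : ℝ) ≤ ((⌈characteristic f ⊤ r₁⌉₊ : ℕ) : ℝ) := Nat.cast_nonneg _
    have := hlarge r hle
    simpa using this.trans (le_add_of_nonneg_left h0)
  · have h1 := characteristic_monotoneOn hf (mem_Ioi.2 (by linarith : 0 < r))
      (mem_Ioi.2 (by linarith [le_max_right r₀ (rexp 1)] : 0 < r₁)) hle
    have h2 := Nat.le_ceil (characteristic f ⊤ r₁)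
    simpa using h1.trans (h2.trans (le_add_of_nonneg_right hpow))

/-! ### Zero-free entire functions of polynomial proximity. -/

theorem exists_exp_eq_of_ne_zero {h : ℂ → ℂ} (hd : Differentiable ℂ h) (h0 : ∀ z, h z ≠ 0) :
    ∃ α : ℂ → ℂ, Differentiable ℂ α ∧ ∀ z, h z = Complex.exp (α z) := by
  have hq : Differentiable ℂ fun z => deriv h z / h z :=
    (hd.contDiff (n := 2)).differentiable_deriv_two.div hd h0
  obtain ⟨g, hg⟩ := hq.isExactOn_univ
  replace hg : ∀ z, HasDerivAt g (deriv h z / h z) z := fun z => hg z (mem_univ z)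
  set α : ℂ → ℂ := fun z => g z - g 0 + Complex.log (h 0) with hα
  have hα' : ∀ z, HasDerivAt α (deriv h z / h z) z := fun z => ((hg z).sub_const _).add_const _
  refine ⟨α, fun z => (hα' z).differentiableAt, fun z => ?_⟩
  have hder : ∀ z, HasDerivAt (fun z => h z * Complex.exp (-α z)) 0 z := fun z => by
    convert! (hd z).hasDerivAt.mul ((hα' z).neg.cexp) using 1
    have := h0 z
    simp only [Pi.neg_apply]
    field_simp
    ring
  have hc := is_const_of_deriv_eq_zero (fun z => (hder z).differentiableAt)
    (fun z => (hder z).deriv) z 0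
  simp only [hα, sub_self, zero_add, Complex.exp_neg (Complex.log (h 0)), Complex.exp_log (h0 0),
    mul_inv_cancel₀ (h0 0)] at hc
  rw [Complex.exp_neg, mul_inv_eq_one₀ (Complex.exp_ne_zero _)] at hc
  exact hc

theorem exists_polynomial_of_norm_le {α : ℂ → ℂ} (hα : Differentiable ℂ α) {q : ℕ[X]}
    (hq : ∀ r : ℝ, 1 ≤ r → ∀ z ∈ sphere (0 : ℂ) r, ‖α z‖ ≤ aeval r q) :
    ∃ P : ℂ[X], ∀ z, α z = P.eval z := by
  have hvan : ∀ n, q.natDegree < n → iteratedDeriv n α 0 = 0 := fun n hn => by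
    set A := n.factorial * aeval (1 : ℝ) q with hA
    have hbd : ∀ r : ℝ, 1 ≤ r → ‖iteratedDeriv n α 0‖ ≤ A * r⁻¹ := fun r hr => by
      have hr0 : 0 < r := by linarith
      refine (Complex.norm_iteratedDeriv_le_of_forall_mem_sphere_norm_le n hr0 hα.diffContOnCl
        (hq r hr)).trans ?_
      have hA1 := aeval_nonneg_of_nonneg q zero_le_one (x := (1 : ℝ))
      rw [div_le_iff₀ (by positivity), hA, mul_assoc, mul_assoc]
      gcongr
      refine (aeval_le_mul_pow q hr).trans ?_
      gcongr
      rw [← div_eq_inv_mul, le_div_iff₀ hr0, ← pow_succ]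
      exact pow_le_pow_right₀ hr hn
    have hlim : Tendsto (fun r : ℝ => A * r⁻¹) atTop (𝓝 0) := by
      simpa using tendsto_inv_atTop_zero.const_mul A
    have := ge_of_tendsto hlim (eventually_atTop.2 ⟨1, hbd⟩)
    exact norm_le_zero_iff.1 this
  refine ⟨∑ n ∈ Finset.range (q.natDegree + 1),
    C ((n.factorial : ℂ)⁻¹ * iteratedDeriv n α 0) * X ^ n, fun z => ?_⟩
  rw [← Complex.taylorSeries_eq_of_entire hα 0 z, tsum_eq_sum (s := Finset.range (q.natDegree + 1))]
  · rw [eval_finsetSum]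
    refine Finset.sum_congr rfl fun n _ => ?_
    simp
    ring
  · intro n hn
    rw [hvan n (by simpa using hn)]
    simp

/-- With h = e^α, a pointwise bound on |h| bounds Re α from above. Borel–Carathéodory then bounds
|α| by a polynomial, and Cauchy's estimates kill the high Taylor coefficients. -/
theorem exists_polynomial_exp {h : ℂ → ℂ} (hd : Differentiable ℂ h) (h0 : ∀ z, h z ≠ 0) {p : ℕ[X]}
    (hp : ∀ r : ℝ, 1 ≤ r → circleAverage (fun w => log⁺ ‖h w‖) 0 r ≤ aeval r p) :
    ∃ P : ℂ[X], ∀ z, h z = Complex.exp (P.eval z) := by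
  obtain ⟨α, hα, hexp⟩ := exists_exp_eq_of_ne_zero hd h0
  have hre : ∀ R : ℝ, 2 ≤ R → ∀ z ∈ closedBall (0 : ℂ) R, (α z).re ≤ 4 * R * aeval (R + 1) p := by
    intro R hR z hz
    have := norm_le_exp_of_circleAverage_le hR (fun x _ => hd.analyticAt x) (fun t ht =>
      (hp t (by linarith [ht.1])).trans
        (aeval_mono_of_nonneg p (by linarith [ht.1]) ht.2.le)) z hz
    rwa [hexp, Complex.norm_exp, Real.exp_le_exp] at this
  set k := ⌈‖α 0‖⌉₊ with hk
  have hbd : ∀ r : ℝ, 1 ≤ r → ∀ z ∈ sphere (0 : ℂ) r, ‖α z‖ ≤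
      aeval r (2 * (4 * (2 * X) * p.comp (2 * X + 1) + 1) + 3 * (k : ℕ[X]) : ℕ[X]) := by
    intro r hr z hz
    have hz' : ‖z‖ = r := by simpa using hz
    have hq0 : 0 ≤ aeval (2 * r + 1) p := aeval_nonneg_of_nonneg p (by linarith)
    -- Outer radius 2r makes the estimate 2M + 3|α(0)|; the `+ 1` makes M strictly positive.
    have hBC := Complex.borelCaratheodory (f := α) (R := 2 * r) (z := z)
      (M := 4 * (2 * r) * aeval (2 * r + 1) p + 1) (by positivity) hα.differentiableOn
      (fun w hw => by
        have := hre (2 * r) (by linarith) w (ball_subset_closedBall hw)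
        simp only [mem_ofPred_eq]
        linarith) (by linarith) (by rw [mem_ball_zero_iff, hz']; linarith)
    have hle : ‖α 0‖ ≤ k := Nat.le_ceil _
    have hval : aeval r (2 * (4 * (2 * X) * p.comp (2 * X + 1) + 1) + 3 * (k : ℕ[X]) : ℕ[X]) =
        2 * (4 * (2 * r) * aeval (2 * r + 1) p + 1) + 3 * (k : ℝ) := by
      simp [map_ofNat, aeval_comp]
    rw [hval]
    rw [hz', show 2 * r - r = r by ring, mul_div_assoc, div_self (by linarith), mul_one,
      show ‖α 0‖ * (2 * r + r) / r = 3 * ‖α 0‖ by field_simp; ring] at hBC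
    linarith
  obtain ⟨P, hP⟩ := exists_polynomial_of_norm_le hα hbd
  exact ⟨P, fun z => by rw [hexp, hP]⟩

/-! ### Consequences of sharing values CM. -/

theorem min_meromorphicOrderAt_sub_const {f : ℂ → ℂ} {z : ℂ} (hf : MeromorphicAt f z) (a : ℂ) :
    min (meromorphicOrderAt (fun w => f w - a) z) 0 = min (meromorphicOrderAt f z) 0 := by
  have hc : 0 ≤ meromorphicOrderAt (fun _ : ℂ => -a) z :=
    AnalyticAt.meromorphicOrderAt_nonneg analyticAt_const
  have hsub : (fun w => f w - a) = f + fun _ => -a := by funext w; simp [sub_eq_add_neg]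
  rw [hsub]
  rcases lt_or_ge (meromorphicOrderAt f z) 0 with h | h
  · rw [meromorphicOrderAt_add_eq_left_of_lt (by fun_prop) (h.trans_le hc)]
  · rw [min_eq_right h, min_eq_right]
    exact le_trans (le_min h hc) (meromorphicOrderAt_add hf (by fun_prop))

/-- Sharing a matches the positive parts of the orders and sharing ∞ the negative parts, which
subtracting a constant does not change. -/
theorem meromorphicOrderAt_sub_const_eq {f g : ℂ → ℂ} (hf : Meromorphic f) (hg : Meromorphic g)
    {a : ℂ} (ha : ShareCM g f a) (hi : ShareInftyCM g f) (z : ℂ) :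
    meromorphicOrderAt (fun w => g w - a) z = meromorphicOrderAt (fun w => f w - a) z := by
  have h1 := ha z
  have h2 := hi z
  rw [← min_meromorphicOrderAt_sub_const (hg z) a, ← min_meromorphicOrderAt_sub_const (hf z) a] at h2
  generalize meromorphicOrderAt (fun w => g w - a) z = x at *
  generalize meromorphicOrderAt (fun w => f w - a) z = y at *
  rcases le_total x 0 with hx | hx <;> rcases le_total y 0 with hy | hy <;>
    simp_all [le_antisymm_iff]

/-- The first main theorem in the one direction needed: the proximity of f to a is at most T(r, f) +
O(1). -/
theorem exists_circleAverage_posLog_inv_le {f : ℂ → ℂ} (hf : Meromorphic f) (a : ℂ) :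
    ∃ K : ℝ, 0 ≤ K ∧ ∀ r : ℝ, 1 ≤ r →
      circleAverage (fun w => log⁺ ‖(f w - a)⁻¹‖) 0 r ≤ characteristic f ⊤ r + K := by
  have hfa : Meromorphic fun w => f w - a := fun z => (hf z).sub (by fun_prop)
  set K := max |Real.log ‖f 0 - a‖| |Real.log ‖meromorphicTrailingCoeffAt (fun w => f w - a) 0‖|
  have hK : 0 ≤ K := (abs_nonneg _).trans (le_max_left _ _)
  have hl2 : 0 ≤ Real.log 2 := Real.log_nonneg one_le_two
  refine ⟨log⁺ ‖a‖ + Real.log 2 + K, by linarith [posLog_nonneg (x := ‖a‖)], fun r hr => ?_⟩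
  have h1 := (abs_le.1 (characteristic_sub_characteristic_inv_le hfa (R := r))).1
  have h2 := (abs_le.1 (abs_characteristic_sub_characteristic_shift_le hf (a₀ := a) (r := r))).1
  have h4 : circleAverage (fun w => log⁺ ‖(f w - a)⁻¹‖) 0 r ≤
      characteristic (fun w => f w - a)⁻¹ ⊤ r := by
    rw [characteristic, Pi.add_apply, proximity_top]
    exact le_add_of_nonneg_right (logCounting_nonneg hr)
  linarith

/-- The quotient (g - a)/(f - a) has order 0 everywhere, so its normal form is entire and zero-free.
Its proximity function is at most that of g - a plus that of 1/(f - a), both polynomially bounded.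
-/
theorem exists_eq_exp_mul_of_share {f g : ℂ → ℂ} (hf : Meromorphic f) (hg : Meromorphic g)
    (hgt : IsTame g) {p : ℕ[X]} (hp : ∀ r : ℝ, 1 ≤ r → characteristic f ⊤ r ≤ aeval r p) {a : ℂ}
    (hfa : ∀ z, meromorphicOrderAt (fun w => f w - a) z ≠ ⊤)
    (ha : ShareCM g f a) (hi : ShareInftyCM g f) :
    ∃ P : ℂ[X], ∀ z, (fun w => g w - a) =ᶠ[𝓝[≠] z]
      fun w => Complex.exp (P.eval w) * (f w - a) := by
  have hfm : Meromorphic fun w => f w - a := fun z => (hf z).sub (by fun_prop)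
  have hgm : Meromorphic fun w => g w - a := fun z => (hg z).sub (by fun_prop)
  have hqm : Meromorphic fun w => (g w - a) * (f w - a)⁻¹ := fun z => (hgm z).mul (hfm z).inv
  have hord : ∀ z, meromorphicOrderAt (fun w => (g w - a) * (f w - a)⁻¹) z = 0 := fun z => by
    have := meromorphicOrderAt_mul (hgm z) (hfm z).inv
    rw [meromorphicOrderAt_inv, meromorphicOrderAt_sub_const_eq hf hg ha hi] at this
    refine this.trans ?_
    lift meromorphicOrderAt (fun w => f w - a) z to ℤ using hfa z with n
    norm_cast
    simp
  set h := toMeromorphicNFOn (fun w => (g w - a) * (f w - a)⁻¹) univ with hh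
  have hhq : ∀ z, h =ᶠ[𝓝[≠] z] fun w => (g w - a) * (f w - a)⁻¹ := fun z =>
    hqm.meromorphicOn.toMeromorphicNFOn_eq_self_on_nhdsNE (mem_univ z)
  have hNF : ∀ z, MeromorphicNFAt h z := fun z =>
    meromorphicNFOn_toMeromorphicNFOn _ univ (mem_univ z)
  have hho : ∀ z, meromorphicOrderAt h z = 0 := fun z => by
    rw [meromorphicOrderAt_toMeromorphicNFOn hqm.meromorphicOn (mem_univ z), hord]
  have hd : Differentiable ℂ h := fun z =>
    ((hNF z).meromorphicOrderAt_nonneg_iff_analyticAt.1 (hho z).ge).differentiableAt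
  have h0 : ∀ z, h z ≠ 0 := fun z => (hNF z).meromorphicOrderAt_eq_zero_iff.1 (hho z)
  obtain ⟨q₁, hq₁⟩ := (hgt.add (IsTame.const (-a))).exists_circleAverage_posLog_le
  obtain ⟨K, -, hK⟩ := exists_circleAverage_posLog_inv_le hf a
  obtain ⟨P, hP⟩ := exists_polynomial_exp hd h0 (p := q₁ + (p + C ⌈K⌉₊)) fun r hr => by
    have hEq : (fun w => log⁺ ‖h w‖) =ᶠ[codiscreteWithin (sphere 0 |r|)]
        fun w => log⁺ ‖(g w - a) * (f w - a)⁻¹‖ := by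
      filter_upwards [eventuallyEq_codiscreteWithin_of_forall fun z _ => hhq z] with w hw
      rw [hw]
    have hi1 := hgm.meromorphicOn.circleIntegrable_posLog_norm (c := 0) (R := r)
    have him : Meromorphic fun w => (f w - a)⁻¹ := fun z => (hfm z).inv
    have hi2 := him.meromorphicOn.circleIntegrable_posLog_norm (c := 0) (R := r)
    rw [circleAverage_congr_codiscreteWithin hEq (by linarith), map_add]
    calc _ ≤ circleAverage (fun w => log⁺ ‖g w - a‖ + log⁺ ‖(f w - a)⁻¹‖) 0 r := by
          refine circleAverage_mono hqm.meromorphicOn.circleIntegrable_posLog_norm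
            (hi1.add hi2) fun w _ => ?_
          rw [norm_mul]
          exact posLog_mul
      _ ≤ _ := by
          rw [circleAverage_fun_add hi1 hi2]
          refine add_le_add (by simpa [sub_eq_add_neg] using hq₁ r hr) ((hK r hr).trans ?_)
          rw [map_add]
          exact add_le_add (hp r hr) (by simpa using Nat.le_ceil K)
  refine ⟨P, fun z => ?_⟩
  filter_upwards [hhq z, (meromorphicOrderAt_ne_top_iff_eventually_ne_zero (hfm z)).1 (hfa z)]
    with w hw hw0
  rw [← hP, hw, inv_mul_cancel_right₀ hw0]

theorem IsTranscendental.meromorphicOrderAt_sub_const_ne_top {f : ℂ → ℂ} (hft : IsTranscendental f)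
    (hf : Meromorphic f) (a z : ℂ) : meromorphicOrderAt (fun w => f w - a) z ≠ ⊤ := by
  have hfm : Meromorphic fun w => f w - a := fun z => (hf z).sub (by fun_prop)
  intro htop
  refine hft ⟨C a, 1, one_ne_zero, eventuallyEq_codiscrete_iff.2 fun w => ?_⟩
  have hw : meromorphicOrderAt (fun w => f w - a) w = ⊤ := by
    by_contra hne
    exact hfm.meromorphicOn.meromorphicOrderAt_ne_top_of_isPreconnected isPreconnected_univ
      (mem_univ w) (mem_univ z) hne htop
  filter_upwards [meromorphicOrderAt_eq_top_iff.1 hw] with x hx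
  simpa using sub_eq_zero.1 hx

theorem meromorphic_iteratedDeriv {f : ℂ → ℂ} (hf : Meromorphic f) (k : ℕ) :
    Meromorphic (iteratedDeriv k f) := by
  induction k with
  | zero => simpa using hf
  | succ k ih => rw [iteratedDeriv_succ]; exact fun z => (ih z).deriv

theorem meromorphic_diffPoly {f : ℂ → ℂ} (hf : Meromorphic f) (n : ℕ) (a : ℕ → ℂ) (c : ℂ) :
    Meromorphic (diffPoly n a c f) := fun z => by
  refine MeromorphicAt.fun_sum fun j _ => MeromorphicAt.mul (by fun_prop) ?_
  exact (hf _).comp_analyticAt (f := f) (g := fun w => w + j * c) (by fun_prop)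

theorem meromorphic_derivPoly {f : ℂ → ℂ} (hf : Meromorphic f) (k : ℕ) (b : ℕ → ℂ) :
    Meromorphic (derivPoly k b f) := fun z => by
  refine MeromorphicAt.add (MeromorphicAt.fun_sum fun j _ => ?_) (by fun_prop)
  exact MeromorphicAt.mul (by fun_prop) (meromorphic_iteratedDeriv hf j z)

/-! ### Lower bound for the characteristic of quotients of exponentials. -/

theorem norm_eval_le {P : ℂ[X]} {d : ℕ} (hP : P.natDegree ≤ d) :
    ∃ K : ℝ, 0 ≤ K ∧ ∀ z : ℂ, 1 ≤ ‖z‖ → ‖P.eval z‖ ≤ K * ‖z‖ ^ d := by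
  refine ⟨∑ i ∈ Finset.range (P.natDegree + 1), ‖P.coeff i‖, by positivity, fun z hz => ?_⟩
  rw [eval_eq_sum_range, Finset.sum_mul]
  refine (norm_sum_le _ _).trans (Finset.sum_le_sum fun i hi => ?_)
  rw [norm_mul, norm_pow]
  gcongr
  · exact (Nat.lt_succ_iff.1 (Finset.mem_range.1 hi)).trans hP

theorem norm_eval_sub_leading_le {P : ℂ[X]} {d : ℕ} (hP : P.natDegree ≤ d + 1) :
    ∃ K : ℝ, 0 ≤ K ∧ ∀ z : ℂ, 1 ≤ ‖z‖ →
      ‖P.eval z - P.coeff (d + 1) * z ^ (d + 1)‖ ≤ K * ‖z‖ ^ d := by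
  obtain ⟨K, hK, h⟩ := norm_eval_le (P := P - C (P.coeff (d + 1)) * X ^ (d + 1)) (d := d) (by
    rw [natDegree_le_iff_coeff_eq_zero]
    intro n hn
    rw [coeff_sub, coeff_C_mul_X_pow]
    split_ifs with h
    · rw [h, sub_self]
    · rw [coeff_eq_zero_of_natDegree_lt (by omega), sub_zero])
  exact ⟨K, hK, fun z hz => by simpa using h z hz⟩

theorem circleAverage_pos_of_continuous {v : ℂ → ℝ} (hv : Continuous v) (h0 : ∀ z, 0 ≤ v z) {u : ℂ}
    (hu : ‖u‖ = 1) (hpos : 0 < v u) : 0 < circleAverage v 0 1 := by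
  rw [circleAverage_def, smul_eq_mul]
  refine mul_pos (by positivity) ?_
  have hmem : u ∈ circleMap 0 1 '' Ioc 0 (2 * π) := by
    rw [image_circleMap_Ioc]; simpa using hu
  obtain ⟨θ, hθ, rfl⟩ := hmem
  exact intervalIntegral.integral_pos (by positivity)
    (hv.comp (continuous_circleMap 0 1)).continuousOn (fun x _ => h0 _)
    ⟨θ, Ioc_subset_Icc_self hθ, hpos⟩

/-- Growth of the circle averages of a positively homogeneous function of the real parts of two
polynomials. -/
theorem exists_le_circleAverage {m : ℝ → ℝ → ℝ} (hm0 : ∀ x y, 0 ≤ m x y)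
    (hlip : ∀ x y x' y', m x y ≤ m x' y' + |x - x'| + |y - y'|)
    (hhom : ∀ t x y, 0 ≤ t → m (t * x) (t * y) = t * m x y)
    (hcont : Continuous fun p : ℝ × ℝ => m p.1 p.2)
    {P Q : ℂ[X]} {d : ℕ} (hP : P.natDegree ≤ d + 1) (hQ : Q.natDegree ≤ d + 1)
    {u : ℂ} (hu : ‖u‖ = 1)
    (hpos : 0 < m (P.coeff (d + 1) * u ^ (d + 1)).re (Q.coeff (d + 1) * u ^ (d + 1)).re) :
    ∃ c : ℝ, 0 < c ∧ ∃ K : ℝ, ∀ r : ℝ, 1 ≤ r →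
      c * r ^ (d + 1) - K * r ^ d ≤
        circleAverage (fun z => m (P.eval z).re (Q.eval z).re) 0 r := by
  -- Ψ keeps only the leading terms. By homogeneity its average over |z| = r is r^(d+1) times that
  -- over the unit circle, which is positive because Ψ(u) > 0; by the Lipschitz condition the
  -- discarded terms cost O(r^d).
  set Ψ : ℂ → ℝ := fun z =>
    m (P.coeff (d + 1) * z ^ (d + 1)).re (Q.coeff (d + 1) * z ^ (d + 1)).re with hΨ
  have hΨc : Continuous Ψ := hcont.comp (f := fun z : ℂ =>
    ((P.coeff (d + 1) * z ^ (d + 1)).re, (Q.coeff (d + 1) * z ^ (d + 1)).re)) (by fun_prop)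
  have hψc : Continuous fun z => m (P.eval z).re (Q.eval z).re := hcont.comp (f := fun z : ℂ =>
    ((P.eval z).re, (Q.eval z).re)) (by fun_prop)
  obtain ⟨K₁, -, hK₁⟩ := norm_eval_sub_leading_le hP
  obtain ⟨K₂, -, hK₂⟩ := norm_eval_sub_leading_le hQ
  refine ⟨circleAverage Ψ 0 1, circleAverage_pos_of_continuous hΨc (fun z => hm0 _ _) hu hpos,
    K₁ + K₂, fun r hr => ?_⟩
  have hr0 : 0 ≤ r := by linarith
  have hscale : r ^ (d + 1) * circleAverage Ψ 0 1 = circleAverage Ψ 0 r := by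
    rw [circleAverage_eq_circleAverage_zero_one (R := r), ← smul_eq_mul, ← circleAverage_fun_smul]
    congr 1
    funext z
    simp only [hΨ, smul_eq_mul, add_zero]
    rw [← hhom _ _ _ (by positivity)]
    congr 1 <;>
    · rw [← Complex.re_ofReal_mul]
      push_cast
      congr 1
      ring
  have hint : ∀ {v : ℂ → ℝ}, Continuous v → CircleIntegrable v 0 r := fun hv =>
    hv.continuousOn.circleIntegrable hr0
  have hle : circleAverage Ψ 0 r ≤
      circleAverage (fun z => m (P.eval z).re (Q.eval z).re + (K₁ + K₂) * r ^ d) 0 r := by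
    refine circleAverage_mono (hint hΨc) (hint (by fun_prop)) fun z hz => ?_
    have hz' : ‖z‖ = r := by simpa [abs_of_nonneg hr0] using hz
    refine (hlip _ _ (P.eval z).re (Q.eval z).re).trans ?_
    have h1 := (Complex.abs_re_le_norm _).trans (hK₁ z (by rw [hz']; exact hr))
    have h2 := (Complex.abs_re_le_norm _).trans (hK₂ z (by rw [hz']; exact hr))
    rw [Complex.sub_re, abs_sub_comm, hz'] at h1 h2
    linarith
  rw [circleAverage_fun_add (hint hψc) (circleIntegrable_const _ _ _), circleAverage_const] at hle
  linarith

theorem exists_norm_eq_one_mul_pow_eq {p : ℂ} (hp : p ≠ 0) {d : ℕ} (hd : 0 < d) {ε : ℂ}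
    (hε : ‖ε‖ = 1) : ∃ u : ℂ, ‖u‖ = 1 ∧ p * u ^ d = ε * ‖p‖ := by
  obtain ⟨u, hu⟩ := IsAlgClosed.exists_pow_nat_eq (ε * ‖p‖ / p) hd
  have hn : ‖p‖ ≠ 0 := norm_ne_zero_iff.2 hp
  refine ⟨u, ?_, by rw [hu]; field_simp⟩
  have : ‖u‖ ^ d = 1 := by
    rw [← norm_pow, hu]
    simp [hε, hn]
  exact (pow_eq_one_iff_of_nonneg (norm_nonneg _) hd.ne').1 this

/-- Equality would force qv = |p| = pv, hence q = p. -/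
theorem re_lt_norm_of_ne {p q v : ℂ} (hpq : p ≠ q) (hle : ‖q‖ ≤ ‖p‖) (hv : ‖v‖ = 1)
    (hpv : p * v = ‖p‖) : (q * v).re < ‖p‖ := by
  have h1 : ‖q * v‖ ≤ ‖p‖ := by rw [norm_mul, hv, mul_one]; exact hle
  refine lt_of_le_of_ne ((Complex.re_le_norm _).trans h1) fun h => hpq ?_
  have h2 : (q * v).re = ‖q * v‖ := le_antisymm (Complex.re_le_norm _) (by rw [h]; exact h1)
  have h3 : q * v = (‖p‖ : ℂ) := by
    have := (Complex.nonneg_iff.1 (Complex.re_eq_norm.1 h2)).2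
    apply Complex.ext
    · simpa using h
    · simpa using this.symm
  have hv0 : v ≠ 0 := norm_ne_zero_iff.1 (by rw [hv]; exact one_ne_zero)
  exact mul_right_cancel₀ hv0 (hpv.trans h3.symm)

/-- Only Re α > Re β + log 2 is not trivial. There |e^α - e^β| ≥ e^(Re α)/2, while |1 - e^β| ≤
2e^(max(Re β, 0)); the two factors 2 give the 4. -/
theorem le_posLog_norm_inv {α β ζ δ : ℂ} (hδ : δ ≠ 0) (hζ : ζ ≠ 0)
    (h : ζ = δ * (1 - Complex.exp β) / (Complex.exp α - Complex.exp β)) :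
    max (α.re - max β.re 0) 0 ≤ log⁺ ‖ζ⁻¹‖ + (Real.log 2 + log⁺ (4 * ‖δ‖)) := by
  have hl2 : 0 < Real.log 2 := Real.log_pos one_lt_two
  have hpl : 0 ≤ log⁺ (4 * ‖δ‖) := posLog_nonneg
  have hz0 : 0 ≤ log⁺ ‖ζ⁻¹‖ := posLog_nonneg
  refine max_le ?_ (by linarith)
  rcases le_or_gt α.re (β.re + Real.log 2) with hle | hlt
  · linarith [le_max_left β.re 0]
  have hnum : 1 - Complex.exp β ≠ 0 := fun h0 => hζ (by rw [h, h0]; simp)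
  have hδ0 : 0 < ‖δ‖ := norm_pos_iff.2 hδ
  have h1 : rexp α.re / 2 ≤ ‖Complex.exp α - Complex.exp β‖ := by
    have := norm_sub_norm_le (Complex.exp α) (Complex.exp β)
    rw [Complex.norm_exp, Complex.norm_exp] at this
    have h2 := Real.exp_lt_exp.2 hlt
    rw [Real.exp_add, Real.exp_log two_pos] at h2
    linarith
  have h2 : ‖1 - Complex.exp β‖ ≤ 2 * rexp (max β.re 0) := by
    refine (norm_sub_le _ _).trans ?_
    rw [norm_one, Complex.norm_exp, two_mul]
    exact add_le_add (Real.one_le_exp (le_max_right _ _)) (Real.exp_le_exp.2 (le_max_left _ _))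
  have h3 : rexp (α.re - max β.re 0) ≤ ‖ζ⁻¹‖ * (4 * ‖δ‖) := by
    have hn0 : 0 < ‖1 - Complex.exp β‖ := norm_pos_iff.2 hnum
    rw [h, norm_inv, norm_div, norm_mul, inv_div, div_mul_eq_mul_div, le_div_iff₀ (by positivity),
      Real.exp_sub, div_mul_eq_mul_div, div_le_iff₀ (by positivity)]
    calc rexp α.re * (‖δ‖ * ‖1 - Complex.exp β‖)
        ≤ (2 * ‖Complex.exp α - Complex.exp β‖) * (‖δ‖ * (2 * rexp (max β.re 0))) := by
          gcongr
          linarith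
      _ = _ := by ring
  have h4 : α.re - max β.re 0 ≤ log⁺ (‖ζ⁻¹‖ * (4 * ‖δ‖)) := by
    refine le_trans ?_ (posLog_le_posLog (Real.exp_pos _).le h3)
    rw [posLog_apply, Real.log_exp]
    exact le_max_right _ _
  linarith [h4.trans posLog_mul]

/-- Only max(Re α, Re β) < -log 2 is not trivial. There |1 - e^β| ≥ 1/2, while the denominator is at
most 2e^(max(Re α, Re β)). -/
theorem le_posLog_norm {α β ζ δ : ℂ} (hδ : δ ≠ 0) (hne : Complex.exp α ≠ Complex.exp β)
    (h : ζ = δ * (1 - Complex.exp β) / (Complex.exp α - Complex.exp β)) :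
    max (-max α.re β.re) 0 ≤ log⁺ ‖ζ‖ + (Real.log 2 + log⁺ (4 / ‖δ‖)) := by
  have hl2 : 0 < Real.log 2 := Real.log_pos one_lt_two
  have hpl : 0 ≤ log⁺ (4 / ‖δ‖) := posLog_nonneg
  have hz0 : 0 ≤ log⁺ ‖ζ‖ := posLog_nonneg
  refine max_le ?_ (by linarith)
  rcases le_or_gt (-Real.log 2) (max α.re β.re) with hle | hlt
  · linarith
  have hδ0 : 0 < ‖δ‖ := norm_pos_iff.2 hδ
  have hE : 0 < ‖Complex.exp α - Complex.exp β‖ := norm_pos_iff.2 (sub_ne_zero.2 hne)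
  have h1 : ‖Complex.exp α - Complex.exp β‖ ≤ 2 * rexp (max α.re β.re) := by
    refine (norm_sub_le _ _).trans ?_
    rw [Complex.norm_exp, Complex.norm_exp, two_mul]
    exact add_le_add (Real.exp_le_exp.2 (le_max_left _ _)) (Real.exp_le_exp.2 (le_max_right _ _))
  have h2 : 1 / 2 ≤ ‖1 - Complex.exp β‖ := by
    have := norm_sub_norm_le 1 (Complex.exp β)
    rw [norm_one, Complex.norm_exp] at this
    have h2 := Real.exp_lt_exp.2 ((le_max_right α.re β.re).trans_lt hlt)
    rw [Real.exp_neg, Real.exp_log two_pos] at h2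
    linarith
  have h3 : rexp (-max α.re β.re) ≤ ‖ζ‖ * (4 / ‖δ‖) := by
    rw [h, norm_div, norm_mul, Real.exp_neg]
    rw [show ‖δ‖ * ‖1 - Complex.exp β‖ / ‖Complex.exp α - Complex.exp β‖ * (4 / ‖δ‖) =
      (4 * ‖1 - Complex.exp β‖) / ‖Complex.exp α - Complex.exp β‖ by field_simp,
      le_div_iff₀ hE, inv_mul_le_iff₀ (Real.exp_pos _)]
    nlinarith [Real.exp_pos (max α.re β.re)]
  have h4 : -max α.re β.re ≤ log⁺ (‖ζ‖ * (4 / ‖δ‖)) := by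
    refine le_trans ?_ (posLog_le_posLog (Real.exp_pos _).le h3)
    rw [posLog_apply, Real.log_exp]
    exact le_max_right _ _
  linarith [h4.trans posLog_mul]

/-- The inequality may fail on a discrete set; replacing v₂ by max(v₁, v₂) makes it hold everywhere
without changing the average. -/
theorem circleAverage_mono_of_eventually {v₁ v₂ : ℂ → ℝ} {c : ℂ} {R : ℝ} (hR : R ≠ 0)
    (h₁ : CircleIntegrable v₁ c R) (h₂ : CircleIntegrable v₂ c R)
    (h : ∀ z, ∀ᶠ w in 𝓝[≠] z, v₁ w ≤ v₂ w) : circleAverage v₁ c R ≤ circleAverage v₂ c R := by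
  have hEq : v₂ =ᶠ[codiscreteWithin (sphere c |R|)] fun w => max (v₁ w) (v₂ w) := by
    rw [Filter.EventuallyEq, Filter.Eventually, mem_codiscreteWithin_iff_forall_mem_nhdsNE]
    intro z _
    filter_upwards [h z] with w hw
    exact Or.inl (max_eq_right hw).symm
  rw [circleAverage_congr_codiscreteWithin hEq hR]
  exact circleAverage_mono h₁ (h₂.congr_codiscreteWithin hEq) fun w _ => le_max_left _ _

theorem exists_le_characteristic {f : ℂ → ℂ} (hf : Meromorphic f) {a δ : ℂ} (hδ : δ ≠ 0)
    {P Q : ℂ[X]} {d : ℕ} (hP : P.natDegree ≤ d + 1) (hQ : Q.natDegree ≤ d + 1)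
    (hlead : ‖Q.coeff (d + 1)‖ ≤ ‖P.coeff (d + 1)‖) (hp : P.coeff (d + 1) ≠ 0)
    (h : ∀ z, ∀ᶠ w in 𝓝[≠] z, Complex.exp (P.eval w) ≠ Complex.exp (Q.eval w) ∧ f w - a ≠ 0 ∧
      f w - a = δ * (1 - Complex.exp (Q.eval w)) /
        (Complex.exp (P.eval w) - Complex.exp (Q.eval w))) :
    ∃ c : ℝ, 0 < c ∧ ∃ K : ℝ, ∀ r : ℝ, 1 ≤ r →
      c * r ^ (d + 1) - K * r ^ d ≤ characteristic f ⊤ r := by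
  have hfa : Meromorphic fun w => f w - a := fun z => (hf z).sub (by fun_prop)
  have hfi : Meromorphic fun w => (f w - a)⁻¹ := fun z => (hfa z).inv
  have hpn : 0 < ‖P.coeff (d + 1)‖ := norm_pos_iff.2 hp
  suffices H : ∃ c : ℝ, 0 < c ∧ ∃ K K' : ℝ, 0 ≤ K' ∧ ∀ r : ℝ, 1 ≤ r →
      c * r ^ (d + 1) - K * r ^ d ≤ characteristic f ⊤ r + K' by
    obtain ⟨c, hc, K, K', hK', H⟩ := H
    refine ⟨c, hc, K + K', fun r hr => ?_⟩
    have : K' ≤ K' * r ^ d := le_mul_of_one_le_right hK' (one_le_pow₀ hr)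
    linarith [H r hr]
  have hl2 : 0 ≤ Real.log 2 := Real.log_nonneg one_le_two
  -- Equal leading coefficients: in a direction where the common leading term is negative, f - a is
  -- large. Otherwise: in the direction where the leading term of P is |p|, that of Q has strictly
  -- smaller real part, so 1/(f - a) is large.
  by_cases hpq : P.coeff (d + 1) = Q.coeff (d + 1)
  · obtain ⟨u, hu, hup⟩ := exists_norm_eq_one_mul_pow_eq hp d.succ_pos (ε := -1) (by simp)
    obtain ⟨c, hc, K, hK⟩ := exists_le_circleAverage (m := fun x y => max (-max x y) 0)
      (fun x y => le_max_right _ _) (fun x y x' y' => by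
        have h1 := neg_abs_le (x - x')
        have h2 := neg_abs_le (y - y')
        rcases max_cases x y with h | h <;> rcases max_cases x' y' with h' | h' <;>
        rcases max_cases (-max x y) 0 with h'' | h'' <;>
        rcases max_cases (-max x' y') 0 with h3 | h3 <;>
        linarith [abs_nonneg (x - x'), abs_nonneg (y - y')])
      (fun t x y ht => by
        rw [← mul_max_of_nonneg _ _ ht, ← mul_neg, mul_max_of_nonneg _ _ ht, mul_zero])
      (by fun_prop) hP hQ hu (by
        rw [← hpq, hup]
        simpa using hpn)
    refine ⟨c, hc, K, log⁺ ‖a‖ + Real.log 2 + (Real.log 2 + log⁺ (4 / ‖δ‖)), ?_,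
      fun r hr => (hK r hr).trans ?_⟩
    · have := posLog_nonneg (x := ‖a‖)
      have := posLog_nonneg (x := 4 / ‖δ‖)
      positivity
    · have hi := hfa.meromorphicOn.circleIntegrable_posLog_norm (c := 0) (R := r)
      refine (circleAverage_mono_of_eventually (by linarith)
        (Continuous.continuousOn (by fun_prop)).circleIntegrable'
        (hi.add (circleIntegrable_const (Real.log 2 + log⁺ (4 / ‖δ‖)) _ _)) fun z => ?_).trans ?_
      · filter_upwards [h z] with w hw
        exact le_posLog_norm hδ hw.1 hw.2.2
      · have h1 : circleAverage (fun w => log⁺ ‖f w - a‖) 0 r ≤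
            characteristic (fun w => f w - a) ⊤ r := by
          rw [characteristic, Pi.add_apply, proximity_top]
          exact le_add_of_nonneg_right (logCounting_nonneg hr)
        have h2 := (abs_le.1
          (abs_characteristic_sub_characteristic_shift_le hf (a₀ := a) (r := r))).1
        rw [circleAverage_add hi (circleIntegrable_const _ _ _), circleAverage_const]
        linarith
  · obtain ⟨u, hu, hup⟩ := exists_norm_eq_one_mul_pow_eq hp d.succ_pos (ε := 1) (by simp)
    rw [one_mul] at hup
    obtain ⟨c, hc, K, hK⟩ := exists_le_circleAverage (m := fun x y => max (x - max y 0) 0)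
      (fun x y => le_max_right _ _) (fun x y x' y' => by
        have h1 := le_abs_self (x - x')
        have h2 := neg_abs_le (y - y')
        rcases max_cases y 0 with h | h <;> rcases max_cases y' 0 with h' | h' <;>
        rcases max_cases (x - max y 0) 0 with h'' | h'' <;>
        rcases max_cases (x' - max y' 0) 0 with h3 | h3 <;>
        linarith [abs_nonneg (x - x'), abs_nonneg (y - y')])
      (fun t x y ht => by
        have : max (t * y) 0 = t * max y 0 := by rw [mul_max_of_nonneg _ _ ht, mul_zero]
        rw [this, ← mul_sub, mul_max_of_nonneg _ _ ht, mul_zero])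
      (by fun_prop) hP hQ hu (by
        have := re_lt_norm_of_ne hpq hlead (v := u ^ (d + 1)) (by rw [norm_pow, hu, one_pow]) hup
        rw [hup, Complex.ofReal_re]
        exact lt_max_of_lt_left (sub_pos.2 (max_lt this hpn)))
    obtain ⟨K₀, hK₀, hinv⟩ := exists_circleAverage_posLog_inv_le hf a
    refine ⟨c, hc, K, K₀ + (Real.log 2 + log⁺ (4 * ‖δ‖)), ?_, fun r hr => (hK r hr).trans ?_⟩
    · have := posLog_nonneg (x := 4 * ‖δ‖)
      positivity
    · have hi := hfi.meromorphicOn.circleIntegrable_posLog_norm (c := 0) (R := r)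
      refine (circleAverage_mono_of_eventually (by linarith)
        (Continuous.continuousOn (by fun_prop)).circleIntegrable'
        (hi.add (circleIntegrable_const (Real.log 2 + log⁺ (4 * ‖δ‖)) _ _)) fun z => ?_).trans ?_
      · filter_upwards [h z] with w hw
        exact le_posLog_norm_inv hδ hw.2.1 hw.2.2
      · rw [circleAverage_add hi (circleIntegrable_const _ _ _), circleAverage_const]
        linarith [hinv r hr]

/-! ### Upper bound for the characteristic and the exact order. -/

theorem characteristic_le_of_norm_le {h : ℂ → ℂ} (hd : Differentiable ℂ h) {r B : ℝ}
    (hB : 0 ≤ B) (hr : 0 ≤ r) (hle : ∀ z, ‖z‖ = r → ‖h z‖ ≤ rexp B) : characteristic h ⊤ r ≤ B := by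
  have han : AnalyticOnNhd ℂ h univ := fun z _ => hd.analyticAt z
  have hlc : logCounting h ⊤ = 0 := by
    rw [logCounting_top, negPart_eq_zero.2 (MeromorphicOn.AnalyticOnNhd.divisor_nonneg han), map_zero]
  have hi : CircleIntegrable (fun w => log⁺ ‖h w‖) 0 r :=
    MeromorphicOn.circleIntegrable_posLog_norm fun z _ => (hd.analyticAt z).meromorphicAt
  rw [characteristic, hlc, add_zero, proximity_top]
  refine circleAverage_mono_on_of_le_circle hi fun w hw => ?_
  refine (posLog_le_posLog (norm_nonneg _)
    (hle w (by simpa [abs_of_nonneg hr] using hw))).trans ?_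
  rw [posLog_apply, Real.log_exp]
  exact max_le hB le_rfl

theorem growthOrder_eq_of_bounds {f : ℂ → ℂ} {d c C : ℝ}
    (hlow : ∀ᶠ r in atTop, d * Real.log r - c ≤ log⁺ (characteristic f ⊤ r))
    (hup : ∀ᶠ r in atTop, log⁺ (characteristic f ⊤ r) ≤ d * Real.log r + C) :
    growthOrder f = (d : EReal) := by
  have hlim : ∀ K : ℝ, Tendsto (fun r : ℝ => d + K / Real.log r) atTop (𝓝 d) := fun K => by
    simpa using (Real.tendsto_log_atTop.const_div_atTop K).const_add d
  have hT : Tendsto (fun r : ℝ => log⁺ (characteristic f ⊤ r) / Real.log r) atTop (𝓝 d) := by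
    refine tendsto_of_tendsto_of_tendsto_of_le_of_le' (hlim (-c)) (hlim C) ?_ ?_
    · filter_upwards [hlow, eventually_gt_atTop 1] with r hr h1
      have hl := Real.log_pos h1
      rw [le_div_iff₀ hl, add_mul, div_mul_cancel₀ _ hl.ne']
      linarith
    · filter_upwards [hup, eventually_gt_atTop 1] with r hr h1
      have hl := Real.log_pos h1
      rw [div_le_iff₀ hl, add_mul, div_mul_cancel₀ _ hl.ne']
      exact hr
  exact ((continuous_coe_real_ereal.tendsto d).comp hT).limsup_eq

theorem eventually_ne_zero_of_exists {h : ℂ → ℂ} (hh : Meromorphic h) {z₀ : ℂ}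
    (h0 : ¬ ∀ᶠ w in 𝓝[≠] z₀, h w = 0) (z : ℂ) : ∀ᶠ w in 𝓝[≠] z, h w ≠ 0 := by
  rw [← meromorphicOrderAt_ne_top_iff_eventually_ne_zero (hh z)]
  exact hh.meromorphicOn.meromorphicOrderAt_ne_top_of_isPreconnected isPreconnected_univ
    (mem_univ z₀) (mem_univ z) fun h => h0 (meromorphicOrderAt_eq_top_iff.1 h)

/-- T(r, f) is at most T of the numerator plus T of the inverse denominator, up to O(1); the first
main theorem replaces the latter by T of the denominator, and both are entire of size exp(O(r^d)).
-/
theorem exists_characteristic_le_mul_pow {f : ℂ → ℂ} (hf : Meromorphic f) {a δ : ℂ}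
    {P Q : ℂ[X]} {d : ℕ} (hP : P.natDegree ≤ d) (hQ : Q.natDegree ≤ d)
    (h : ∀ z, ∀ᶠ w in 𝓝[≠] z, Complex.exp (P.eval w) ≠ Complex.exp (Q.eval w) ∧ f w - a ≠ 0 ∧
      f w - a = δ * (1 - Complex.exp (Q.eval w)) /
        (Complex.exp (P.eval w) - Complex.exp (Q.eval w))) :
    ∃ C : ℝ, 0 ≤ C ∧ ∀ r : ℝ, 1 ≤ r → characteristic f ⊤ r ≤ C * r ^ d := by
  set N : ℂ → ℂ := fun w => δ * (1 - Complex.exp (Q.eval w)) with hN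
  set E : ℂ → ℂ := fun w => Complex.exp (P.eval w) - Complex.exp (Q.eval w) with hE
  have hNd : Differentiable ℂ N := by fun_prop
  have hEd : Differentiable ℂ E := by fun_prop
  have hNm : Meromorphic N := fun z => (hNd.analyticAt z).meromorphicAt
  have hEm : Meromorphic E := fun z => (hEd.analyticAt z).meromorphicAt
  have hEi : Meromorphic E⁻¹ := fun z => (hEm z).inv
  have hNt : ∀ z, meromorphicOrderAt N z ≠ ⊤ := fun z => by
    rw [meromorphicOrderAt_ne_top_iff_eventually_ne_zero (hNm z)]
    filter_upwards [h z] with w hw hw0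
    exact hw.2.1 (by rw [hw.2.2]; simp only [hN] at hw0; rw [hw0, zero_div])
  have hEt : ∀ z, meromorphicOrderAt E⁻¹ z ≠ ⊤ := fun z => by
    rw [meromorphicOrderAt_ne_top_iff_eventually_ne_zero (hEi z)]
    filter_upwards [h z] with w hw
    exact inv_ne_zero (sub_ne_zero.2 hw.1)
  obtain ⟨K₁, hK₁, hP'⟩ := norm_eval_le hP
  obtain ⟨K₂, hK₂, hQ'⟩ := norm_eval_le hQ
  set K := max |Real.log ‖E 0‖| |Real.log ‖meromorphicTrailingCoeffAt E 0‖| with hK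
  have hK0 : 0 ≤ K := (abs_nonneg _).trans (le_max_left _ _)
  have hl2 : 0 ≤ Real.log 2 := Real.log_nonneg one_le_two
  have hpa := posLog_nonneg (x := ‖a‖)
  have hexp : ∀ z : ℂ, ‖Complex.exp z‖ ≤ rexp ‖z‖ := fun z => by
    rw [Complex.norm_exp]; exact Real.exp_le_exp.2 (Complex.re_le_norm z)
  refine ⟨(‖δ‖ + (1 + K₂)) + (1 + (K₁ + K₂)) + (K + log⁺ ‖a‖ + Real.log 2), by positivity,
    fun r hr => ?_⟩
  have hr0 : 0 ≤ r := by linarith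
  have hrd : 1 ≤ r ^ d := one_le_pow₀ hr
  have h1 := (abs_le.1 (abs_characteristic_sub_characteristic_shift_le hf (a₀ := a) (r := r))).2
  have h2 : characteristic (fun w => f w - a) ⊤ r = characteristic (N * E⁻¹) ⊤ r := by
    refine characteristic_congr_codiscrete (eventuallyEq_codiscrete_iff.2 fun z => ?_) (by linarith)
    filter_upwards [h z] with w hw
    rw [hw.2.2, Pi.mul_apply, Pi.inv_apply, ← div_eq_mul_inv]
  have h3 := characteristic_mul_top_le hr hNm hNt hEi hEt
  have h4 := (abs_le.1 (characteristic_sub_characteristic_inv_le hEm (R := r))).1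
  have h5 : characteristic N ⊤ r ≤ ‖δ‖ + (1 + K₂ * r ^ d) := by
    refine characteristic_le_of_norm_le hNd (by positivity) hr0 fun z hz => ?_
    rw [hN, norm_mul, Real.exp_add]
    gcongr
    · linarith [Real.add_one_le_exp ‖δ‖]
    · refine (norm_sub_le _ _).trans (le_trans ?_ (two_mul_exp_le (x := K₂ * r ^ d) le_rfl))
      rw [norm_one]
      refine add_le_add (Real.one_le_exp (by positivity)) ((hexp _).trans (Real.exp_le_exp.2 ?_))
      rw [← hz]
      exact hQ' z (by rw [hz]; exact hr)
  have h6 : characteristic E ⊤ r ≤ 1 + (K₁ + K₂) * r ^ d := by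
    refine characteristic_le_of_norm_le hEd (by positivity) hr0 fun z hz => ?_
    have hKr₁ : 0 ≤ K₁ * r ^ d := by positivity
    have hKr₂ : 0 ≤ K₂ * r ^ d := by positivity
    refine (norm_sub_le _ _).trans (le_trans (add_le_add ((hexp _).trans (Real.exp_le_exp.2 ?_))
      ((hexp _).trans (Real.exp_le_exp.2 ?_)))
      (two_mul_exp_le (x := (K₁ + K₂) * r ^ d) le_rfl))
    · have := hP' z (by rw [hz]; exact hr)
      rw [hz] at this
      linarith
    · have := hQ' z (by rw [hz]; exact hr)
      rw [hz] at this
      linarith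
  rw [Pi.add_apply] at h3
  have h7 : ∀ x : ℝ, 0 ≤ x → x ≤ x * r ^ d := fun x hx => le_mul_of_one_le_right hx hrd
  have h8 := h7 ‖δ‖ (norm_nonneg _)
  have h9 := h7 (K + log⁺ ‖a‖ + Real.log 2) (by positivity)
  linarith

theorem growthOrder_eq_natCast {f : ℂ → ℂ} {d : ℕ} {C : ℝ}
    (hup : ∀ r : ℝ, 1 ≤ r → characteristic f ⊤ r ≤ C * r ^ d)
    (hlow : ∀ e, d = e + 1 → ∃ c : ℝ, 0 < c ∧ ∃ K : ℝ, ∀ r : ℝ, 1 ≤ r →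
      c * r ^ (e + 1) - K * r ^ e ≤ characteristic f ⊤ r) :
    growthOrder f = ((d : ℝ) : EReal) := by
  have hU : ∀ᶠ r : ℝ in atTop, log⁺ (characteristic f ⊤ r) ≤ d * Real.log r + log⁺ C := by
    filter_upwards [eventually_ge_atTop 1] with r hr
    have hrd : 1 ≤ r ^ d := one_le_pow₀ hr
    refine (posLog_le_posLog (characteristic_nonneg hr) (hup r hr)).trans (posLog_mul.trans ?_)
    rw [posLog_eq_log (x := r ^ d) (by rwa [abs_of_nonneg (by positivity)]), Real.log_pow, add_comm]
  -- For d = 0 the characteristic is bounded, and log⁺ ≥ 0 is already the matching lower bound.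
  rcases d with - | e
  · refine growthOrder_eq_of_bounds (c := 0) (Eventually.of_forall fun r => ?_) hU
    simpa using posLog_nonneg
  · obtain ⟨c, hc, K, hK⟩ := hlow e rfl
    refine growthOrder_eq_of_bounds (c := -Real.log (c / 2)) ?_ hU
    filter_upwards [eventually_ge_atTop 1, eventually_ge_atTop (2 * K / c)] with r hr hrK
    have hr0 : 0 < r := by linarith
    have h1 : K * r ^ e ≤ c / 2 * r ^ (e + 1) := by
      rw [pow_succ', ← mul_assoc]
      gcongr
      rw [div_le_iff₀ hc] at hrK
      linarith
    have h2 : c / 2 * r ^ (e + 1) ≤ characteristic f ⊤ r := by linarith [hK r hr]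
    have h3 : Real.log (c / 2 * r ^ (e + 1)) ≤ log⁺ (characteristic f ⊤ r) :=
      (Real.log_le_log (by positivity) h2).trans (by rw [posLog_apply]; exact le_max_right _ _)
    rw [Real.log_mul (by positivity) (by positivity), Real.log_pow] at h3
    linarith

end MeroShare

/-! ### The uniqueness theorem. -/

open MeroShare ValueDistribution in
theorem theorem2p1 (f : ℂ → ℂ) (hf : Meromorphic f) (hft : MeroShare.IsTranscendental f)
    (hint : ∀ m : ℤ, MeroShare.growthOrder f ≠ ((m : ℝ) : EReal))
    (hfin : MeroShare.growthOrder f ≠ ⊤)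
    (c : ℂ) (hc : ¬ (fun z => f (z + c)) =ᶠ[Filter.codiscrete ℂ] f)
    (n : ℕ) (A : ℕ → ℂ) (hA : A n ≠ 0)
    (k : ℕ) (B : ℕ → ℂ) (hB : B k ≠ 0)
    (a b : ℂ) (hab : a ≠ b)
    (hsa : MeroShare.ShareCM (MeroShare.diffPoly n A c f + MeroShare.derivPoly k B f) f a)
    (hsb : MeroShare.ShareCM (MeroShare.diffPoly n A c f + MeroShare.derivPoly k B f) f b)
    (hsi : MeroShare.ShareInftyCM (MeroShare.diffPoly n A c f + MeroShare.derivPoly k B f) f) :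
    MeroShare.diffPoly n A c f + MeroShare.derivPoly k B f =ᶠ[Filter.codiscrete ℂ] f := by
  obtain ⟨p, hp⟩ := exists_characteristic_le_of_growthOrder_ne_top hf hfin
  have hft' := isTame_of_characteristic_le hf hp
  set g := MeroShare.diffPoly n A c f + MeroShare.derivPoly k B f with hg
  have hgt : IsTame g := (hft'.diffPoly n A c).add (hft'.derivPoly k B)
  have hgm : Meromorphic g := fun z =>
    (meromorphic_diffPoly hf n A c z).add (meromorphic_derivPoly hf k B z)
  have hfa := hft.meromorphicOrderAt_sub_const_ne_top hf
  obtain ⟨P, hP⟩ := exists_eq_exp_mul_of_share hf hgm hgt hp (hfa a) hsa hsi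
  obtain ⟨Q, hQ⟩ := exists_eq_exp_mul_of_share hf hgm hgt hp (hfa b) hsb hsi
  by_contra hne
  rw [eventuallyEq_codiscrete_iff, not_forall] at hne
  obtain ⟨z₀, hz₀⟩ := hne
  have hba : b - a ≠ 0 := sub_ne_zero.2 hab.symm
  have hEm : Meromorphic fun w => Complex.exp (P.eval w) - Complex.exp (Q.eval w) := fun z =>
    (Differentiable.analyticAt (by fun_prop) z).meromorphicAt
  -- If e^P = e^Q near z₀, subtracting the two relations gives (e^P - 1)(b - a) = 0, so e^P = 1 and
  -- g = f near z₀.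
  have hE := eventually_ne_zero_of_exists hEm (z₀ := z₀) fun h0 => hz₀ (by
    filter_upwards [h0, hP z₀, hQ z₀] with w h0 h1 h2
    have hPQ := sub_eq_zero.1 h0
    have h3 : (Complex.exp (P.eval w) - 1) * (b - a) = 0 := by
      rw [← hPQ] at h2; linear_combination h2 - h1
    have h4 : Complex.exp (P.eval w) = 1 :=
      sub_eq_zero.1 ((mul_eq_zero.1 h3).resolve_right hba)
    rw [h4] at h1
    linear_combination h1)
  have hfne : ∀ d z, ∀ᶠ w in nhdsWithin z {z}ᶜ, f w - d ≠ 0 := fun d z =>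
    (meromorphicOrderAt_ne_top_iff_eventually_ne_zero ((hf z).sub (by fun_prop))).1 (hfa d z)
  have hforma : ∀ z, ∀ᶠ w in nhdsWithin z {z}ᶜ,
      Complex.exp (P.eval w) ≠ Complex.exp (Q.eval w) ∧ f w - a ≠ 0 ∧
      f w - a = (b - a) * (1 - Complex.exp (Q.eval w)) /
        (Complex.exp (P.eval w) - Complex.exp (Q.eval w)) := fun z => by
    filter_upwards [hE z, hP z, hQ z, hfne a z] with w h0 h1 h2 h3
    refine ⟨sub_ne_zero.1 h0, h3, ?_⟩
    rw [eq_div_iff h0]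
    linear_combination h2 - h1
  -- The same identity with (a, P) and (b, Q) exchanged; it lets the polynomial with the larger
  -- leading coefficient always come first in the lower bound.
  have hformb : ∀ z, ∀ᶠ w in nhdsWithin z {z}ᶜ,
      Complex.exp (Q.eval w) ≠ Complex.exp (P.eval w) ∧ f w - b ≠ 0 ∧
      f w - b = (a - b) * (1 - Complex.exp (P.eval w)) /
        (Complex.exp (Q.eval w) - Complex.exp (P.eval w)) := fun z => by
    filter_upwards [hE z, hP z, hQ z, hfne b z] with w h0 h1 h2 h3
    have h0' := sub_ne_zero.2 (sub_ne_zero.1 h0).symm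
    refine ⟨(sub_ne_zero.1 h0).symm, h3, ?_⟩
    rw [eq_div_iff h0']
    linear_combination h1 - h2
  obtain ⟨C, -, hup⟩ := exists_characteristic_le_mul_pow hf
    (le_max_left P.natDegree Q.natDegree) (le_max_right _ _) hforma
  refine hint (max P.natDegree Q.natDegree : ℕ) ?_
  rw [growthOrder_eq_natCast hup fun e he => ?_]
  · norm_cast
  · have hPe : P.natDegree ≤ e + 1 := he ▸ le_max_left _ _
    have hQe : Q.natDegree ≤ e + 1 := he ▸ le_max_right _ _
    -- The coefficient of degree max(deg P, deg Q) vanishes in at most one of P and Q, so the one of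
    -- larger modulus is nonzero.
    have hlead : P.coeff (e + 1) ≠ 0 ∨ Q.coeff (e + 1) ≠ 0 := by
      have hcoeff : ∀ R : ℂ[X], R.natDegree = e + 1 → R.coeff (e + 1) ≠ 0 := fun R hR => by
        rw [← hR, coeff_natDegree, leadingCoeff_ne_zero]
        rintro rfl
        simp at hR
      rcases max_choice P.natDegree Q.natDegree with h | h
      · exact Or.inl (hcoeff P (h ▸ he))
      · exact Or.inr (hcoeff Q (h ▸ he))
    rcases le_total ‖Q.coeff (e + 1)‖ ‖P.coeff (e + 1)‖ with hle | hle
    · refine exists_le_characteristic hf hba hPe hQe hle (fun h0 => ?_) hforma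
      rw [h0, norm_zero, norm_le_zero_iff] at hle
      tauto
    · refine exists_le_characteristic hf (sub_ne_zero.2 hab) hQe hPe hle (fun h0 => ?_) hformb
      rw [h0, norm_zero, norm_le_zero_iff] at hle
      tauto
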